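/- Let $V$ be a finite set of vertices and let $G=(V,A)$ be either an undirected graph (undirected case) or an acyclic directed graph (directed case). **Separation.** In the undirected case, a set $M\subseteq V$ separates $X,Y\subseteq V$ if every path from a vertex of $X$ to a vertex of $Y$ (a single vertex being a path) has a vertex, possibly an end point, in $M$. In the directed case, a trail is a sequence of vertices $v_0,\dots,v_k$ in which any two consecutive vertices are joined by an arc in one direction or the other; $v_i$ is a v-structure of it if $0<i<k$ and $(v_{i-1},v_i),(v_{i+1},v_i)\in A$; the trail is active given $M$ if none of its vertices that is not a v-structure is in $M$ and each of its v-structures is in $M$ or has a descendant in $M$; and $M$ d-separates $X$ and $Y$ if no trail from a vertex of $X$ to a vertex of $Y$ is active given $M$. In either case we then write $X\perp Y\mid M$. For $C\subseteq V$ let $\mathrm{An}^*(C)$ be $C$ together with all the ascendants of its elements. **Separators.** Let $B,D,E\subseteq V$. A (d-)separator between $B$ and $D$ given $E$ is a set $M\subseteq V\setminus(B\cup D)$ such that $B\perp D\mid M\cup E$. It is minimal if $B\perp D\mid M'\cup E$ fails for every strict subset $M'$ of $M$. A Markov blanket of $B$ in the direction of $D$ given $E$ is a minimal (d-)separator $M$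 between $B$ and $D$ given $E$ such that $D\perp M\mid M'\cup E$ for every (d-)separator $M'$ between $B$ and $D$ given $E$; when it exists and is unique it is denoted $\mathrm{mb}(B\to D\mid E)$. **Markov blanket in a set.** Consider random variables $X_v$, $v\in V$, with values in arbitrary finite sets. Their joint distribution factorizes on $G$ if, in the undirected case, its mass function is proportional to a product of nonnegative functions, each depending only on the variables of a clique of $G$, and, in the directed case, it is the product over $v\in V$ of conditional distributions of $X_v$ given the variables of the parents of $v$. For $B,C,E\subseteq V$, the Markov blanket $\mathrm{mb}_C(B\mid E)$ of $B$ in $C$ given $E$ is the set $N\subseteq C\setminus B$ such that, for each $M\subseteq C\setminus B$, one has $N\subseteq M$ if and only if $X_B$ and $X_{C\setminus(B\cup M)}$ are independent given $X_{M\cup E}$ for all distributions that factorize on $G$. (At most one set $N$ has this property.) **Theorem.** Let $B,D,E\subseteq V$ be such that there exists a (d-)separator between $B$ and $D$ given $E$. Then the Markov blanket of $B$ in the direction of $D$ given $E$ exists and is unique; the Markov blankets in sets below exist; and $$\mathrm{mb}(B\to D\mid E)=\mathrm{mb}_{\mathrm{mb}_V(B\mid E)}(D\mid E)$$ in the undirected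 case, and $$\mathrm{mb}(B\to D\mid E)=\mathrm{mb}_{\mathrm{mb}_{\mathrm{An}^*(B\cup D\cup E)}(B\mid E)}(D\mid E)$$ in the directed case. -/

import Mathlib

open scoped BigOperators

namespace GraphicalModel

universe u

/-! ### Graph separation -/

section Separation

variable {V : Type u}

/-- `M` separates `X` and `Y` in the undirected graph `G`: no path from a vertex of `X` to a
vertex of `Y` avoids `M` (end points included; a single vertex is a path). -/
def Separates (G : SimpleGraph V) (X Y M : Set V) : Prop :=
  ∀ x ∈ X, ∀ y ∈ Y, ∀ P : G.Walk x y, ∃ w ∈ P.support, w ∈ M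

/-- A directed graph is acyclic if it has no directed path of positive length from a vertex to
itself. -/
def IsAcyclic (G : Digraph V) : Prop :=
  ∀ v, ¬ Relation.TransGen G.Adj v v

/-- The vertices of `C` together with all their ascendants. -/
def ascendantsWithSelf (G : Digraph V) (C : Set V) : Set V :=
  {a | ∃ c ∈ C, Relation.ReflTransGen G.Adj a c}

/-- The vertex `v` together with all its descendants. -/
def descendantsWithSelf (G : Digraph V) (v : V) : Set V :=
  {d | Relation.ReflTransGen G.Adj v d}

/-- `P 0, …, P k` is a trail from `x` to `y`: consecutive vertices are joined by an arc, in
one direction or the other. -/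
def IsTrail (G : Digraph V) (x y : V) (k : ℕ) (P : ℕ → V) : Prop :=
  P 0 = x ∧ P k = y ∧ ∀ i < k, G.Adj (P i) (P (i + 1)) ∨ G.Adj (P (i + 1)) (P i)

/-- The `i`-th vertex of the trail `P 0, …, P k` is a v-structure. -/
def IsVStructure (G : Digraph V) (k : ℕ) (P : ℕ → V) (i : ℕ) : Prop :=
  0 < i ∧ i < k ∧ G.Adj (P (i - 1)) (P i) ∧ G.Adj (P (i + 1)) (P i)

/-- The trail `P 0, …, P k` is active given `M`: its vertices that are not v-structures are
outside `M`, and each of its v-structures is in `M` or has a descendant in `M`. -/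
def IsActiveTrail (G : Digraph V) (M : Set V) (k : ℕ) (P : ℕ → V) : Prop :=
  ∀ i ≤ k, (¬ IsVStructure G k P i → P i ∉ M) ∧
    (IsVStructure G k P i → (descendantsWithSelf G (P i) ∩ M).Nonempty)

/-- `M` d-separates `X` and `Y` in the directed graph `G`. -/
def DSeparates (G : Digraph V) (X Y M : Set V) : Prop :=
  ∀ x ∈ X, ∀ y ∈ Y, ∀ (k : ℕ) (P : ℕ → V), IsTrail G x y k P → ¬ IsActiveTrail G M k P

end Separation

/-! ### Distributions that factorize on a graph

The variable of the vertex `v` takes its values in the finite set `S v`. A distribution on the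
product is given by its mass function, an element of `stdSimplex ℝ (∀ v, S v)`. -/

noncomputable section Distributions

variable {V : Type u} [Fintype V] [DecidableEq V]

/-- The probability of an event under the mass function `p`. -/
def prob {S : V → Type} [∀ v, Fintype (S v)] (p : (∀ v, S v) → ℝ) (A : Set (∀ v, S v)) : ℝ :=
  ∑ ω, A.indicator p ω

/-- The event that the variables indexed by `X` take the values prescribed by `x`. -/
def cylinder {S : V → Type} (X : Set V) (x : ∀ v, S v) : Set (∀ v, S v) :=
  {ω | ∀ v ∈ X, ω v = x v}

/-- Under `p`, the subvectors indexed by `X` and by `Y` are independent given the one indexed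
by `Z`. -/
def CondIndep {S : V → Type} [∀ v, Fintype (S v)] (p : (∀ v, S v) → ℝ) (X Y Z : Set V) : Prop :=
  ∀ x y z : ∀ v, S v,
    prob p (cylinder X x ∩ cylinder Y y ∩ cylinder Z z) * prob p (cylinder Z z) =
      prob p (cylinder X x ∩ cylinder Z z) * prob p (cylinder Y y ∩ cylinder Z z)

/-- `p` is a probability distribution that factorizes as an undirected graphical model on `G`:
it is proportional to a product of nonnegative functions of the variables of cliques. -/
def FactorizesUndirected (G : SimpleGraph V) {S : V → Type} [∀ v, Fintype (S v)]
    (p : (∀ v, S v) → ℝ) : Prop :=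
  p ∈ stdSimplex ℝ (∀ v, S v) ∧
    ∃ (𝒞 : Finset (Finset V)) (ψ : ∀ C : Finset V, (∀ v : C, S v) → ℝ) (Z : ℝ),
      (∀ C ∈ 𝒞, G.IsClique (C : Set V)) ∧ (∀ C xC, 0 ≤ ψ C xC) ∧
        ∀ x, p x = 1 / Z * ∏ C ∈ 𝒞, ψ C (fun v => x v)

/-- `p` is a probability distribution that factorizes as a directed graphical model on `G`: it
is the product over all vertices of conditional distributions given the parents. -/
def FactorizesDirected (G : Digraph V) {S : V → Type} [∀ v, Fintype (S v)]
    (p : (∀ v, S v) → ℝ) : Prop :=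
  p ∈ stdSimplex ℝ (∀ v, S v) ∧
    ∃ q : ∀ v : V, (∀ u : {u : V // G.Adj u v}, S u) → S v → ℝ,
      (∀ v xpa, q v xpa ∈ stdSimplex ℝ (S v)) ∧
        ∀ x, p x = ∏ v, q v (fun u => x u) (x v)

/-- `X` and `Y` are independent given `Z` under every distribution, on any finite state spaces,
that factorizes as an undirected graphical model on `G`. -/
def IndepUndirected (G : SimpleGraph V) (X Y Z : Set V) : Prop :=
  ∀ (S : V → Type) [∀ v, Fintype (S v)] (p : (∀ v, S v) → ℝ),
    FactorizesUndirected G p → CondIndep p X Y Z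

/-- `X` and `Y` are independent given `Z` under every distribution, on any finite state spaces,
that factorizes as a directed graphical model on `G`. -/
def IndepDirected (G : Digraph V) (X Y Z : Set V) : Prop :=
  ∀ (S : V → Type) [∀ v, Fintype (S v)] (p : (∀ v, S v) → ℝ),
    FactorizesDirected G p → CondIndep p X Y Z

end Distributions

/-! ### Markov blankets and separators

The following notions are common to the directed and the undirected case. Below, `indep X Y Z`
stands for `IndepUndirected G X Y Z` or `IndepDirected G X Y Z`, and `sep X Y Z` for
`Separates G X Y Z` or `DSeparates G X Y Z`. -/

section Blankets

variable {V : Type u}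

/-- `N` is the Markov blanket of `B` in `C` given `E`, i.e. `N = mb_C(B | E)`: it is a subset of
`C \ B`, and a subset `M` of `C \ B` makes `B` and the rest of `C` independent given `M ∪ E` if
and only if it contains `N`. -/
def IsMarkovBlanketIn (indep : Set V → Set V → Set V → Prop) (C B E N : Set V) : Prop :=
  N ⊆ C \ B ∧ ∀ M ⊆ C \ B, indep B (C \ (B ∪ M)) (M ∪ E) ↔ N ⊆ M

theorem IsMarkovBlanketIn.unique {indep : Set V → Set V → Set V → Prop} {C B E N N' : Set V}
    (h : IsMarkovBlanketIn indep C B E N) (h' : IsMarkovBlanketIn indep C B E N') : N = N' :=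
  Set.Subset.antisymm
    ((h.2 N' h'.1).1 ((h'.2 N' h'.1).2 subset_rfl))
    ((h'.2 N h.1).1 ((h.2 N h.1).2 subset_rfl))

/-- `M` is a (d-)separator between `B` and `D` given `E`. -/
def IsSeparator (sep : Set V → Set V → Set V → Prop) (B D E M : Set V) : Prop :=
  Disjoint M (B ∪ D) ∧ sep B D (M ∪ E)

/-- `M` is a minimal (d-)separator between `B` and `D` given `E`. -/
def IsMinimalSeparator (sep : Set V → Set V → Set V → Prop) (B D E M : Set V) : Prop :=
  IsSeparator sep B D E M ∧ ∀ M', M' ⊂ M → ¬ sep B D (M' ∪ E)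

/-- `M` is a Markov blanket of `B` in the direction of `D` given `E`. -/
def IsDirectionalMarkovBlanket (sep : Set V → Set V → Set V → Prop) (B D E M : Set V) : Prop :=
  IsMinimalSeparator sep B D E M ∧ ∀ M', IsSeparator sep B D E M' → sep D M (M' ∪ E)

end Blankets

end GraphicalModel

/-! Everything is reduced to paths in one undirected graph `H`: the given graph or, in the directed
case, the moral graph of the ancestral set of `B ∪ D ∪ E`. Two equivalences allow this. Independence
under all factorizing distributions is graph separation (`indepUndirected_iff`,
`indepDirected_iff`): soundness by exchanging coordinates between two configurations, completeness
by explicit distributions. And d-separation is separation in the moral graph of the ancestral set of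
the three sets (`dSeparates_iff`).

In `H`, the blanket of `B` is its boundary `N`, and the blanket of `D` in `N` is the frontier `F`,
the part of `N` that paths from `D` avoiding `E` meet first. The key observation is
`Reach.notMem_boundary`: if `M` separates `B` from `D` given `E`, a path from `D` avoiding `M ∪ E`
cannot arrive in `N`, as one more edge would lead into `B \ E`. Hence `D` is separated from `F` by
`M ∪ E`, and no strict subset of `F` separates, a missing vertex of `F` being reachable. `F` itself
separates, since every path from `D` to `B` avoiding `E` crosses `N`, first in `F`. Uniqueness is
`eq_frontier_of_minimal`.

In the directed case the relevant ancestral set varies with the sets being separated.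
`Reach.restrict` controls this: paths that are separated from `B` are not affected by removing
ascendants of `B` only. -/

namespace GraphicalModel

universe u

/-! ### Reachability and separation in undirected graphs -/

section Reachability

variable {V : Type u}

/-- The vertices that can be reached in `H` from `X` by a path avoiding `Z`. -/
inductive Reach (H : SimpleGraph V) (X Z : Set V) : V → Prop
  | start {x : V} : x ∈ X → x ∉ Z → Reach H X Z x
  | step {a b : V} : Reach H X Z a → H.Adj a b → b ∉ Z → Reach H X Z b

theorem Reach.notMem {H : SimpleGraph V} {X Z : Set V} {v : V} (h : Reach H X Z v) : v ∉ Z := by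
  cases h <;> assumption

theorem Reach.mono {H H' : SimpleGraph V} {X Z Z' : Set V} {v : V} (hH : H ≤ H') (hZ : Z' ⊆ Z)
    (h : Reach H X Z v) : Reach H' X Z' v := by
  induction h with
  | start hx hz => exact .start hx fun h => hz (hZ h)
  | step _ hab hb ih => exact .step ih (hH hab) fun h => hb (hZ h)

theorem Reach.of_walk {H : SimpleGraph V} {X Z : Set V} {a b : V} (P : H.Walk a b)
    (ha : Reach H X Z a) (hP : ∀ w ∈ P.support, w ∉ Z) : Reach H X Z b := by
  induction P with
  | nil => exact ha
  | cons hab P ih =>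
    refine ih (.step ha hab (hP _ ?_)) fun w hw => hP w ?_
    · simp
    · simp [hw]

theorem Reach.exists_walk {H : SimpleGraph V} {X Z : Set V} {v : V} (h : Reach H X Z v) :
    ∃ x ∈ X, ∃ P : H.Walk x v, ∀ w ∈ P.support, w ∉ Z := by
  induction h with
  | @start x hx hz => exact ⟨x, hx, .nil, by simpa using hz⟩
  | step _ hab hb ih =>
    obtain ⟨x, hx, P, hP⟩ := ih
    refine ⟨x, hx, P.concat hab, fun w hw => ?_⟩
    rw [SimpleGraph.Walk.support_concat] at hw
    simp only [List.mem_append, List.mem_singleton] at hw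
    rcases hw with hw | rfl
    · exact hP w hw
    · exact hb

theorem separates_iff {H : SimpleGraph V} {X Y Z : Set V} :
    Separates H X Y Z ↔ ∀ y ∈ Y, ¬ Reach H X Z y := by
  constructor
  · intro h y hy hr
    obtain ⟨x, hx, P, hP⟩ := hr.exists_walk
    obtain ⟨w, hw, hwZ⟩ := h x hx y hy P
    exact hP w hw hwZ
  · intro h x hx y hy P
    by_contra! hc
    exact h y hy (.of_walk P (.start hx (hc x P.start_mem_support)) hc)

theorem Separates.symm {H : SimpleGraph V} {X Y Z : Set V} (h : Separates H X Y Z) :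
    Separates H Y X Z := by
  intro y hy x hx P
  obtain ⟨w, hw, hwZ⟩ := h x hx y hy P.reverse
  exact ⟨w, by simpa using hw, hwZ⟩

theorem Separates.not_reach {H : SimpleGraph V} {X Y Z : Set V} (h : Separates H X Y Z) {x : V}
    (hx : x ∈ X) : ¬ Reach H Y Z x :=
  separates_iff.1 h.symm x hx

theorem Separates.anti {H H' : SimpleGraph V} {X Y Z Z' : Set V} (hH : H' ≤ H)
    (hZ : Z ⊆ Z') (h : Separates H X Y Z) : Separates H' X Y Z' :=
  separates_iff.2 fun y hy hr => separates_iff.1 h y hy (hr.mono hH hZ)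

/-- A reached vertex is still reached when `Z` is enlarged, or some vertex of the enlargement
is reached. -/
theorem Reach.enlarge {H : SimpleGraph V} {X Z Z' : Set V} {v : V} (h : Reach H X Z v)
    (hno : ∀ w, Reach H X Z w → w ∉ Z') : Reach H X Z' v := by
  induction h with
  | start hx hz => exact .start hx (hno _ (.start hx hz))
  | step ha hab hb ih => exact .step ih hab (hno _ (.step ha hab hb))

end Reachability

/-! ### Ancestral sets and moral graphs -/

section Moral

variable {V : Type u}

theorem subset_ascendantsWithSelf (G : Digraph V) (C : Set V) : C ⊆ ascendantsWithSelf G C :=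
  fun c hc => ⟨c, hc, .refl⟩

theorem ascendantsWithSelf_mono (G : Digraph V) {C C' : Set V} (h : C ⊆ C') :
    ascendantsWithSelf G C ⊆ ascendantsWithSelf G C' :=
  fun _ ⟨c, hc, hac⟩ => ⟨c, h hc, hac⟩

theorem mem_ascendantsWithSelf_of_adj {G : Digraph V} {C : Set V} {u v : V} (huv : G.Adj u v)
    (hv : v ∈ ascendantsWithSelf G C) : u ∈ ascendantsWithSelf G C := by
  obtain ⟨c, hc, h⟩ := hv
  exact ⟨c, hc, .head huv h⟩

theorem ascendantsWithSelf_subset {G : Digraph V} {C C' : Set V}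
    (h : C ⊆ ascendantsWithSelf G C') : ascendantsWithSelf G C ⊆ ascendantsWithSelf G C' := by
  rintro a ⟨c, hc, hac⟩
  obtain ⟨d, hd, hcd⟩ := h hc
  exact ⟨d, hd, hac.trans hcd⟩

/-- The moral graph of the subgraph of `G` induced on `W`, as a graph on all the vertices. -/
def moralGraph (G : Digraph V) (W : Set V) : SimpleGraph V where
  Adj u v := u ≠ v ∧ u ∈ W ∧ v ∈ W ∧
    (G.Adj u v ∨ G.Adj v u ∨ ∃ c ∈ W, G.Adj u c ∧ G.Adj v c)
  symm := ⟨by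
    rintro u v ⟨h, hu, hv, h' | h' | ⟨c, hc, huc, hvc⟩⟩
    · exact ⟨h.symm, hv, hu, .inr (.inl h')⟩
    · exact ⟨h.symm, hv, hu, .inl h'⟩
    · exact ⟨h.symm, hv, hu, .inr (.inr ⟨c, hc, hvc, huc⟩)⟩⟩
  loopless := ⟨fun _ h => h.1 rfl⟩

theorem moralGraph_mono (G : Digraph V) {W W' : Set V} (h : W ⊆ W') :
    moralGraph G W ≤ moralGraph G W' := by
  rintro u v ⟨hne, hu, hv, h' | h' | ⟨c, hc, h'⟩⟩
  · exact ⟨hne, h hu, h hv, .inl h'⟩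
  · exact ⟨hne, h hu, h hv, .inr (.inl h')⟩
  · exact ⟨hne, h hu, h hv, .inr (.inr ⟨c, h hc, h'⟩)⟩

theorem IsAcyclic.ne_of_adj {G : Digraph V} (hG : IsAcyclic G) {u v : V} (h : G.Adj u v) :
    u ≠ v := by
  rintro rfl
  exact hG u (.single h)

theorem IsAcyclic.asymm {G : Digraph V} (hG : IsAcyclic G) {u v : V} (h : G.Adj u v) :
    ¬ G.Adj v u :=
  fun h' => hG u (.tail (.single h) h')

theorem moralGraph_adj_of_adj {G : Digraph V} (hG : IsAcyclic G) {C : Set V} {u v : V}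
    (h : G.Adj u v) (hv : v ∈ ascendantsWithSelf G C) :
    (moralGraph G (ascendantsWithSelf G C)).Adj u v :=
  ⟨hG.ne_of_adj h, mem_ascendantsWithSelf_of_adj h hv, hv, .inl h⟩

/-- In the moral graph of an ancestral set, a vertex reached along paths that are separated from
`B` lies in every smaller ancestral set that only misses ascendants of `B`. -/
theorem Reach.mem_ascendants {G : Digraph V} (hG : IsAcyclic G) {B C₁ C₂ X Z : Set V}
    (hdiff : C₁ ⊆ B ∪ ascendantsWithSelf G C₂)
    (hX : X ⊆ C₂) (hZ : Z ⊆ C₂)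
    (hsep : Separates (moralGraph G (ascendantsWithSelf G C₁)) X B Z) {v : V}
    (hv : Reach (moralGraph G (ascendantsWithSelf G C₁)) X Z v) :
    v ∈ ascendantsWithSelf G C₂ := by
  by_contra hv2
  have hv1 : v ∈ ascendantsWithSelf G C₁ := by
    cases hv with
    | start hx _ => exact absurd (subset_ascendantsWithSelf G _ (hX hx)) hv2
    | step _ h _ => exact h.2.2.1
  obtain ⟨c, hc, hvc⟩ := hv1
  -- Outside the ancestral set of `C₂` arcs can be followed downwards without meeting `Z`; the
  -- descent ends in `C₁`, hence in `B`, against the separation.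
  induction hvc using Relation.ReflTransGen.head_induction_on with
  | refl =>
    rcases hdiff hc with h | h
    · exact separates_iff.1 hsep c h hv
    · exact hv2 h
  | @head a b hab hbc ih =>
    have hb2 : b ∉ ascendantsWithSelf G C₂ := fun h => hv2 (mem_ascendantsWithSelf_of_adj hab h)
    exact ih (hv.step (moralGraph_adj_of_adj hG hab ⟨c, hc, hbc⟩)
      fun h => hb2 (subset_ascendantsWithSelf G _ (hZ h))) hb2

/-- Only an edge due to a common child could be lost. If that child were outside the smaller
ancestral set, it would itself be reached, which `Reach.mem_ascendants` excludes. -/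
theorem Reach.moralGraph_adj {G : Digraph V} (hG : IsAcyclic G) {B C₁ C₂ X Z : Set V}
    (hdiff : C₁ ⊆ B ∪ ascendantsWithSelf G C₂)
    (hX : X ⊆ C₂) (hZ : Z ⊆ C₂)
    (hsep : Separates (moralGraph G (ascendantsWithSelf G C₁)) X B Z) {v w : V}
    (hv : Reach (moralGraph G (ascendantsWithSelf G C₁)) X Z v)
    (hw : w ∈ ascendantsWithSelf G C₂)
    (h : (moralGraph G (ascendantsWithSelf G C₁)).Adj v w) :
    (moralGraph G (ascendantsWithSelf G C₂)).Adj v w := by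
  refine ⟨h.1, hv.mem_ascendants hG hdiff hX hZ hsep, hw, ?_⟩
  rcases h.2.2.2 with h' | h' | ⟨c, hc, hvc, hwc⟩
  · exact .inl h'
  · exact .inr (.inl h')
  · refine .inr (.inr ⟨c, ?_, hvc, hwc⟩)
    by_contra hc2
    exact hc2 ((hv.step (moralGraph_adj_of_adj hG hvc hc)
      fun h => hc2 (subset_ascendantsWithSelf G _ (hZ h))).mem_ascendants hG hdiff hX hZ hsep)

theorem Reach.restrict {G : Digraph V} (hG : IsAcyclic G) {B C₁ C₂ X Z : Set V}
    (hdiff : C₁ ⊆ B ∪ ascendantsWithSelf G C₂)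
    (hX : X ⊆ C₂) (hZ : Z ⊆ C₂)
    (hsep : Separates (moralGraph G (ascendantsWithSelf G C₁)) X B Z) {v : V}
    (hv : Reach (moralGraph G (ascendantsWithSelf G C₁)) X Z v) :
    Reach (moralGraph G (ascendantsWithSelf G C₂)) X Z v := by
  induction hv with
  | start hx hz => exact .start hx hz
  | step ha hab hb ih =>
    exact .step ih (ha.moralGraph_adj hG hdiff hX hZ hsep
      ((ha.step hab hb).mem_ascendants hG hdiff hX hZ hsep) hab) hb

end Moral

/-! ### d-separation and moral graphs -/

section DSeparation

variable {V : Type u}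

theorem IsVStructure.prev {G : Digraph V} (hG : IsAcyclic G) {k : ℕ} {P : ℕ → V} {i : ℕ}
    (h : IsVStructure G k P (i + 1)) : ¬ IsVStructure G k P i :=
  fun h' => hG.asymm h.2.2.1 h'.2.2.2

/-- A vertex of an active trail with an arc to the next one is an ascendant of the end of the
trail or of the conditioning set. -/
theorem IsActiveTrail.mem_of_adj_succ {G : Digraph V} {x y : V} {k : ℕ} {P : ℕ → V} {M : Set V}
    (hP : IsTrail G x y k P) (hM : IsActiveTrail G M k P) :
    ∀ j i, i + j = k → (j ≠ 0 → G.Adj (P i) (P (i + 1))) →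
      P i ∈ ascendantsWithSelf G (insert y M) := by
  intro j
  induction j with
  | zero =>
    intro i hi _
    exact ⟨y, .inl rfl, by rw [← hP.2.1, ← hi]; exact .refl⟩
  | succ j ih =>
    intro i hi h
    have h := h (by omega)
    refine mem_ascendantsWithSelf_of_adj h ?_
    by_cases hv : IsVStructure G k P (i + 1)
    · obtain ⟨z, hz, hzM⟩ := (hM (i + 1) (by omega)).2 hv
      exact ⟨z, .inr hzM, hz⟩
    · refine ih (i + 1) (by omega) fun hj => ?_
      rcases hP.2.2 (i + 1) (by omega) with h' | h'
      · exact h'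
      · exact absurd ⟨by omega, by omega, h, h'⟩ hv

theorem IsActiveTrail.mem_of_adj_pred {G : Digraph V} {x y : V} {k : ℕ} {P : ℕ → V} {M : Set V}
    (hP : IsTrail G x y k P) (hM : IsActiveTrail G M k P) :
    ∀ i, i ≤ k → (∀ j, i = j + 1 → G.Adj (P i) (P j)) →
      P i ∈ ascendantsWithSelf G (insert x M) := by
  intro i
  induction i with
  | zero =>
    intro _ _
    exact ⟨x, .inl rfl, by rw [← hP.1]⟩
  | succ i ih =>
    intro hi h
    have h := h i rfl
    refine mem_ascendantsWithSelf_of_adj h ?_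
    by_cases hv : IsVStructure G k P i
    · obtain ⟨z, hz, hzM⟩ := (hM i (by omega)).2 hv
      exact ⟨z, .inr hzM, hz⟩
    · refine ih (by omega) fun j hj => ?_
      subst hj
      rcases hP.2.2 j (by omega) with h' | h'
      · exact absurd ⟨by omega, by omega, h', h⟩ hv
      · exact h'

/-- From a vertex that is not a v-structure, the arcs can be followed along the trail in one of its
directions until an end point, or a v-structure with a descendant in `M`. -/
theorem IsActiveTrail.mem_ascendants {G : Digraph V} {x y : V} {k : ℕ} {P : ℕ → V} {M : Set V}
    (hP : IsTrail G x y k P) (hM : IsActiveTrail G M k P) {i : ℕ} (hi : i ≤ k) :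
    P i ∈ ascendantsWithSelf G (insert x (insert y M)) := by
  by_cases hv : IsVStructure G k P i
  · obtain ⟨z, hz, hzM⟩ := (hM i hi).2 hv
    exact ⟨z, .inr (.inr hzM), hz⟩
  by_cases hsucc : i < k → G.Adj (P i) (P (i + 1))
  · refine ascendantsWithSelf_mono G (Set.subset_insert _ _)
      (hM.mem_of_adj_succ hP (k - i) i (by omega) fun h => hsucc (by omega))
  · push Not at hsucc
    refine ascendantsWithSelf_mono G (Set.insert_subset_insert (Set.subset_insert _ _))
      (hM.mem_of_adj_pred hP i hi fun j hj => ?_)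
    subst hj
    rcases hP.2.2 j (by omega) with h' | h'
    · have := (hP.2.2 (j + 1) hsucc.1).resolve_left hsucc.2
      exact absurd ⟨by omega, hsucc.1, h', this⟩ hv
    · exact h'

/-- The non-colliders of an active trail are reached in the moral graph. -/
theorem IsActiveTrail.reach {G : Digraph V} (hG : IsAcyclic G) {x y : V} {k : ℕ} {P : ℕ → V}
    {M X C : Set V} (hP : IsTrail G x y k P) (hM : IsActiveTrail G M k P) (hx : x ∈ X)
    (hC : insert x (insert y M) ⊆ C) :
    ∀ i ≤ k, ¬ IsVStructure G k P i →
      Reach (moralGraph G (ascendantsWithSelf G C)) X M (P i) := by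
  have hmem : ∀ i ≤ k, P i ∈ ascendantsWithSelf G C := fun i hi =>
    ascendantsWithSelf_mono G hC (hM.mem_ascendants hP hi)
  intro i
  induction i using Nat.strong_induction_on with
  | _ i ih =>
    intro hi hv
    have hiM := (hM i hi).1 hv
    obtain _ | i := i
    · exact .start (hP.1 ▸ hx) hiM
    by_cases hv' : IsVStructure G k P i
    -- A v-structure is bypassed: its neighbours on the trail are two of its parents, so they are
    -- equal or joined in the moral graph. By acyclicity the one before it is not a v-structure.
    · obtain ⟨h0, hik, h1, h2⟩ := hv'
      obtain ⟨j, rfl⟩ := Nat.exists_eq_succ_of_ne_zero h0.ne'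
      have hj := ih j (by omega) (by omega) (IsVStructure.prev hG ⟨h0, hik, h1, h2⟩)
      simp only [Nat.succ_eq_add_one, Nat.add_sub_cancel] at h1 h2 hiM ⊢
      by_cases he : P j = P (j + 1 + 1)
      · rw [← he]; exact hj
      · exact hj.step ⟨he, hmem _ (by omega), hmem _ hi, .inr (.inr ⟨_, hmem _ hik.le, h1, h2⟩)⟩ hiM
    · have hj := ih i (by omega) (by omega) hv'
      rcases hP.2.2 i (by omega) with h | h
      · exact hj.step (moralGraph_adj_of_adj hG h (hmem _ hi)) hiM
      · exact hj.step (moralGraph_adj_of_adj hG h (hmem _ (by omega))).symm hiM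

/-- `BallReach G X Z v d`: a trail from `X` whose inner vertices do not block it given `Z` arrives
at `v`, along an arc into `v` if `d = true`, and not along such an arc if `d = false`. -/
inductive BallReach (G : Digraph V) (X Z : Set V) : V → Bool → Prop
  | start {x : V} : x ∈ X → BallReach G X Z x false
  | down {a b : V} {d : Bool} : BallReach G X Z a d → a ∉ Z → G.Adj a b → BallReach G X Z b true
  | up {a b : V} : BallReach G X Z a false → a ∉ Z → G.Adj b a → BallReach G X Z b false
  | bounce {a b : V} : BallReach G X Z a true → a ∈ ascendantsWithSelf G Z → G.Adj b a →
      BallReach G X Z b false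

/-- Activity is required only before the last vertex, whose status is settled by the next arc; `d`
records whether an arc entering it from the far side would make it a v-structure. -/
theorem BallReach.exists_trail {G : Digraph V} (hG : IsAcyclic G) {X Z : Set V} {v : V} {d : Bool}
    (h : BallReach G X Z v d) :
    ∃ x ∈ X, ∃ k P, IsTrail G x v k P ∧
      (∀ i < k, (¬ IsVStructure G k P i → P i ∉ Z) ∧
        (IsVStructure G k P i → (descendantsWithSelf G (P i) ∩ Z).Nonempty)) ∧
      (d = true ↔ 0 < k ∧ G.Adj (P (k - 1)) (P k)) := by
  have extend : ∀ {x a b : V} {k : ℕ} {P : ℕ → V}, IsTrail G x a k P →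
      (∀ i < k, (¬ IsVStructure G k P i → P i ∉ Z) ∧
        (IsVStructure G k P i → (descendantsWithSelf G (P i) ∩ Z).Nonempty)) →
      (G.Adj a b ∨ G.Adj b a) →
      ((0 < k ∧ G.Adj (P (k - 1)) (P k)) ∧ G.Adj b a → a ∈ ascendantsWithSelf G Z) →
      (¬ ((0 < k ∧ G.Adj (P (k - 1)) (P k)) ∧ G.Adj b a) → a ∉ Z) →
      ∃ k' P', IsTrail G x b k' P' ∧
        (∀ i < k', (¬ IsVStructure G k' P' i → P' i ∉ Z) ∧
          (IsVStructure G k' P' i → (descendantsWithSelf G (P' i) ∩ Z).Nonempty)) ∧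
        (G.Adj a b ↔ 0 < k' ∧ G.Adj (P' (k' - 1)) (P' k')) := by
    intro x a b k P hP hact hab hcol hnon
    have hle : ∀ i ≤ k, (fun i => if i ≤ k then P i else b) i = P i := fun i hi => if_pos hi
    have hlast : (fun i => if i ≤ k then P i else b) (k + 1) = b := if_neg (by omega)
    generalize (fun i => if i ≤ k then P i else b) = Q at hle hlast
    have hQk : Q k = a := by rw [hle k le_rfl, hP.2.1]
    refine ⟨k + 1, Q, ⟨by rw [hle 0 (by omega), hP.1], hlast, fun i hi => ?_⟩,
      fun i hi => ?_, by simp [hlast, hQk]⟩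
    · rcases Nat.lt_succ_iff_lt_or_eq.1 hi with hi | rfl
      · rw [hle i hi.le, hle (i + 1) hi]; exact hP.2.2 i hi
      · rw [hQk, hlast]; exact hab
    · rcases Nat.lt_succ_iff_lt_or_eq.1 hi with hi | rfl
      · have : IsVStructure G (k + 1) Q i ↔ IsVStructure G k P i := by
          simp only [IsVStructure, hle i hi.le, hle (i + 1) hi, hle (i - 1) (by omega)]
          simp [hi, Nat.lt_succ_of_lt hi]
        rw [this, hle i hi.le]
        exact hact i hi
      · have : IsVStructure G (i + 1) Q i ↔
            (0 < i ∧ G.Adj (P (i - 1)) (P i)) ∧ G.Adj b a := by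
          simp only [IsVStructure, hlast, hle i le_rfl, hle (i - 1) (by omega), hP.2.1]
          simp [and_assoc]
        rw [this, hQk]
        refine ⟨hnon, fun h => ?_⟩
        obtain ⟨z, hz, haz⟩ := hcol h
        exact ⟨z, haz, hz⟩
  induction h with
  | @start x hx =>
    exact ⟨x, hx, 0, fun _ => x, ⟨rfl, rfl, by simp⟩, by simp, by simp⟩
  | @down a b d _ haZ hab ih =>
    obtain ⟨x, hx, k, P, hP, hact, hd⟩ := ih
    obtain ⟨k', P', h1, h2, h3⟩ := extend hP hact (.inl hab)
      (fun h => absurd h.2 (hG.asymm hab)) (fun _ => haZ)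
    exact ⟨x, hx, k', P', h1, h2, by simp [← h3, hab]⟩
  | @up a b _ haZ hba ih =>
    obtain ⟨x, hx, k, P, hP, hact, hd⟩ := ih
    obtain ⟨k', P', h1, h2, h3⟩ := extend hP hact (.inr hba)
      (fun h => absurd (hd.2 h.1) (by simp)) (fun _ => haZ)
    exact ⟨x, hx, k', P', h1, h2, by simp [← h3, hG.asymm hba]⟩
  | @bounce a b _ haZ hba ih =>
    obtain ⟨x, hx, k, P, hP, hact, hd⟩ := ih
    obtain ⟨k', P', h1, h2, h3⟩ := extend hP hact (.inr hba)
      (fun _ => haZ) (fun h => absurd ⟨hd.1 rfl, hba⟩ h)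
    exact ⟨x, hx, k', P', h1, h2, by simp [← h3, hG.asymm hba]⟩

theorem DSeparates.not_ballReach {G : Digraph V} (hG : IsAcyclic G) {X Y Z : Set V}
    (h : DSeparates G X Y Z) {y : V} (hy : y ∈ Y) (hyZ : y ∉ Z) {d : Bool} :
    ¬ BallReach G X Z y d := by
  intro hb
  obtain ⟨x, hx, k, P, hP, hact, -⟩ := hb.exists_trail hG
  refine h x hx y hy k P hP fun i hi => ?_
  rcases hi.lt_or_eq with hi | rfl
  · exact hact i hi
  · exact ⟨fun _ => by rw [hP.2.1]; exact hyZ, fun hv => absurd hv.2.1 (lt_irrefl _)⟩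

/-- If `X` and `Y` are d-separated and an arc into `a` may be followed, then so may be the arcs
into `a` in the reverse direction. -/
theorem BallReach.turn {G : Digraph V} (hG : IsAcyclic G) {X Y Z : Set V}
    (hsep : DSeparates G X Y Z) {a b : V} (h : BallReach G X Z a true)
    (ha : a ∈ ascendantsWithSelf G (X ∪ Y ∪ Z)) (hba : G.Adj b a) : BallReach G X Z b false := by
  by_cases haZ : a ∈ ascendantsWithSelf G Z
  · exact h.bounce haZ hba
  -- Now no vertex below `a` is in `Z`, so descent is free. Arrival in `Y` would contradict
  -- d-separation; so the descendant `c` is in `X`, and a new trail can start at `c` and climb to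
  -- `a`.
  obtain ⟨c, hc, hac⟩ := ha
  have hcZ : c ∉ Z := fun hc => haZ ⟨c, hc, hac⟩
  have hcX : c ∈ X := by
    by_contra hcX
    refine hsep.not_ballReach hG ((hc.resolve_right hcZ).resolve_left hcX) hcZ (d := true) ?_
    induction hac using Relation.ReflTransGen.head_induction_on generalizing b with
    | refl => exact h
    | @head a e hae _ ih =>
      exact ih (b := a) (h.down (fun h => haZ (subset_ascendantsWithSelf G Z h)) hae) hae
        fun h => haZ (mem_ascendantsWithSelf_of_adj hae h)
  refine .up ?_ (fun h => haZ (subset_ascendantsWithSelf G Z h)) hba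
  clear h hba
  induction hac using Relation.ReflTransGen.head_induction_on with
  | refl => exact .start hcX
  | @head a e hae _ ih =>
    have heZ : e ∉ ascendantsWithSelf G Z := fun h => haZ (mem_ascendantsWithSelf_of_adj hae h)
    exact .up (ih heZ) (fun h => heZ (subset_ascendantsWithSelf G Z h)) hae

/-- An edge between two parents of `c` is replaced by descending to `c` and turning there, which
`BallReach.turn` permits for every vertex of the ancestral set. -/
theorem DSeparates.ballReach_of_reach {G : Digraph V} (hG : IsAcyclic G) {X Y Z : Set V}
    (hsep : DSeparates G X Y Z) {v : V}
    (h : Reach (moralGraph G (ascendantsWithSelf G (X ∪ Y ∪ Z))) X Z v) :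
    ∃ d, BallReach G X Z v d := by
  induction h with
  | start hx _ => exact ⟨false, .start hx⟩
  | @step a b ha hab hb ih =>
    obtain ⟨d, hd⟩ := ih
    obtain ⟨-, haW, -, h | h | ⟨c, hcW, hac, hbc⟩⟩ := hab
    · exact ⟨true, hd.down ha.notMem h⟩
    · cases d with
      | false => exact ⟨false, hd.up ha.notMem h⟩
      | true => exact ⟨false, hd.turn hG hsep haW h⟩
    · exact ⟨false, (hd.down ha.notMem hac).turn hG hsep hcW hbc⟩

theorem dSeparates_iff {G : Digraph V} (hG : IsAcyclic G) {X Y Z : Set V} :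
    DSeparates G X Y Z ↔ Separates (moralGraph G (ascendantsWithSelf G (X ∪ Y ∪ Z))) X Y Z := by
  constructor
  · refine fun h => separates_iff.2 fun y hy hr => ?_
    obtain ⟨d, hd⟩ := h.ballReach_of_reach hG hr
    exact h.not_ballReach hG hy hr.notMem hd
  · intro h x hx y hy k P hP hM
    refine separates_iff.1 h y hy ?_
    rw [← hP.2.1]
    refine hM.reach hG hP hx ?_ k le_rfl fun hv => absurd hv.2.1 (lt_irrefl _)
    rintro z (rfl | rfl | hz)
    · exact .inl (.inl hx)
    · exact .inl (.inr hy)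
    · exact .inr hz

end DSeparation

/-! ### Blankets in an undirected graph -/

section UndirectedBlankets

variable {V : Type u}

/-- The vertices outside `B ∪ E` with a neighbour in `B \ E`. -/
def boundary (H : SimpleGraph V) (B E : Set V) : Set V :=
  {w | w ∉ B ∧ w ∉ E ∧ ∃ b ∈ B, b ∉ E ∧ H.Adj b w}

/-- The vertices of `N` that are the first vertex in `N` of some path from `D` avoiding `E`. -/
def frontier (H : SimpleGraph V) (N D E : Set V) : Set V :=
  {n | n ∈ N ∧ ∃ u, Reach H D (N ∪ E) u ∧ H.Adj u n}

/-- A path avoiding `E` can leave `B` only through the boundary; conversely, a boundary vertex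
outside `M` is joined to `B` by an unblocked edge. -/
theorem separates_boundary_iff {H : SimpleGraph V} {B C E M : Set V}
    (hC : boundary H B E ⊆ C) (hM : M ⊆ C \ B) :
    Separates H B (C \ (B ∪ M)) (M ∪ E) ↔ boundary H B E ⊆ M := by
  rw [separates_iff]
  constructor
  · intro h w hw
    obtain ⟨hwB, hwE, b, hb, hbE, hbw⟩ := id hw
    by_contra hwM
    refine h w ⟨hC hw, fun h => h.elim hwB hwM⟩ (.step (.start hb ?_) hbw ?_)
    · exact fun h => h.elim (fun h => (hM h).2 hb) hbE
    · exact fun h => h.elim hwM hwE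
  · intro h y hy hr
    refine hy.2 (.inl ?_)
    clear hy
    induction hr with
    | start hx _ => exact hx
    | @step a b ha hab hb ih =>
      by_contra hbB
      exact hb (.inl (h ⟨hbB, fun h => hb (.inr h), a, ih, fun h => ha.notMem (.inr h), hab⟩))

/-- A path from `D` to a vertex of `N` meets `N` for the first time in the frontier. -/
theorem Reach.avoids_of_frontier {H : SimpleGraph V} {N D E K : Set V} (hND : Disjoint N D)
    (hK : frontier H N D E ⊆ K) {v : V} (h : Reach H D (K ∪ E) v) : Reach H D (N ∪ E) v := by
  induction h with
  | start hx hz =>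
    refine .start hx fun h => h.elim (fun h => hND.ne_of_mem h hx rfl) fun h => hz (.inr h)
  | @step a b _ hab hb ih =>
    refine ih.step hab fun h => h.elim (fun h => ?_) fun h => hb (.inr h)
    exact hb (.inl (hK ⟨h, a, ih, hab⟩))

theorem separates_frontier_iff {H : SimpleGraph V} {N D E K : Set V} (hND : Disjoint N D)
    (hNE : Disjoint N E) (hK : K ⊆ N \ D) :
    Separates H D (N \ (D ∪ K)) (K ∪ E) ↔ frontier H N D E ⊆ K := by
  rw [separates_iff]
  constructor
  · rintro h n ⟨hn, u, hu, hun⟩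
    by_contra hnK
    refine h n ⟨hn, fun h => h.elim (fun h => hND.ne_of_mem hn h rfl) hnK⟩
      ((hu.mono le_rfl (Set.union_subset_union_left _ fun _ h => (hK h).1)).step hun ?_)
    exact fun h => h.elim hnK fun h => hNE.ne_of_mem hn h rfl
  · intro h y hy hr
    exact (hr.avoids_of_frontier hND h).notMem (.inl hy.1)

theorem disjoint_boundary (H : SimpleGraph V) (B E : Set V) : Disjoint (boundary H B E) E :=
  Set.disjoint_left.2 fun _ h => h.2.1

theorem disjoint_boundary_of_separates {H : SimpleGraph V} {B D E S : Set V}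
    (hS : Disjoint S (B ∪ D)) (h : Separates H B D (S ∪ E)) : Disjoint (boundary H B E) D := by
  rw [Set.disjoint_left]
  rintro w ⟨_, hwE, b, hb, hbE, hbw⟩ hwD
  refine separates_iff.1 h w hwD (.step (.start hb ?_) hbw ?_)
  · exact fun h => h.elim (fun h => hS.ne_of_mem h (.inl hb) rfl) hbE
  · exact fun h => h.elim (fun h => hS.ne_of_mem h (.inr hwD) rfl) hwE

theorem inter_subset_of_separates {H : SimpleGraph V} {B D E S : Set V}
    (hS : Disjoint S (B ∪ D)) (h : Separates H B D (S ∪ E)) : B ∩ D ⊆ E := by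
  rintro x ⟨hB, hD⟩
  by_contra hxE
  exact separates_iff.1 h x hD
    (.start hB fun h => h.elim (fun h => hS.ne_of_mem h (.inl hB) rfl) hxE)

theorem separates_boundary {H : SimpleGraph V} {B D E : Set V} (hBD : B ∩ D ⊆ E) :
    Separates H D B (boundary H B E ∪ E) := by
  refine separates_iff.2 fun b hb hr => ?_
  have : ∀ v, Reach H D (boundary H B E ∪ E) v → v ∉ B := by
    intro v hv
    induction hv with
    | start hx hz => exact fun h => hz (.inr (hBD ⟨h, hx⟩))
    | @step a b ha hab hb ih =>
      intro hbB
      exact ha.notMem (.inl ⟨ih, fun h => ha.notMem (.inr h), b, hbB,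
        fun h => hb (.inr h), hab.symm⟩)
  exact this b hr hb

theorem separates_frontier {H : SimpleGraph V} {B D E : Set V} (hBD : B ∩ D ⊆ E)
    (hND : Disjoint (boundary H B E) D) :
    Separates H B D (frontier H (boundary H B E) D E ∪ E) := by
  refine Separates.symm (separates_iff.2 fun b hb hr => ?_)
  exact separates_iff.1 (separates_boundary hBD) b hb (hr.avoids_of_frontier hND subset_rfl)

/-- If a path from `D` avoiding `M ∪ E` ends in a neighbour of `B \ E`, then `M` is not a
separator. -/
theorem Reach.notMem_boundary {H : SimpleGraph V} {B D E M : Set V} (hMB : Disjoint M B)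
    (h : Separates H B D (M ∪ E)) {v : V} (hv : Reach H D (M ∪ E) v) : v ∉ boundary H B E := by
  rintro ⟨_, _, b, hb, hbE, hbv⟩
  exact h.not_reach hb
    (hv.step hbv.symm fun h => h.elim (fun h => hMB.ne_of_mem h hb rfl) hbE)

/-- A frontier vertex missing from `M` is reached from `D` without touching the rest of the
boundary, and has a neighbour in `B \ E`. -/
theorem not_separates_of_ssubset_frontier {H : SimpleGraph V} {B D E M : Set V}
    (hM : M ⊂ frontier H (boundary H B E) D E) : ¬ Separates H B D (M ∪ E) := by
  intro h
  obtain ⟨m, hm, hmM⟩ := Set.exists_of_ssubset hM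
  obtain ⟨hmN, u, hu, hum⟩ := hm
  have hMB : Disjoint M B := Set.disjoint_left.2 fun x hx hxB => (hM.1 hx).1.1 hxB
  refine Reach.notMem_boundary hMB h (.step (hu.mono le_rfl ?_) hum ?_) hmN
  · exact Set.union_subset_union_left _ fun _ h => (hM.1 h).1
  · exact fun h => h.elim hmM hmN.2.1

/-- The larger graph `H'` serves the directed case, where a d-separator may enlarge the ancestral
set. -/
theorem separates_frontier_of_separates {H H' : SimpleGraph V} (hH : H ≤ H') {B D E M : Set V}
    (hMB : Disjoint M B) (h : Separates H' B D (M ∪ E)) :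
    Separates H' D (frontier H (boundary H B E) D E) (M ∪ E) := by
  refine separates_iff.2 fun y hy hr => ?_
  obtain ⟨hyB, hyE, b, hb, hbE, hby⟩ := hy.1
  exact hr.notMem_boundary hMB h ⟨hyB, hyE, b, hb, hbE, hH hby⟩

/-- It suffices that `M` is contained in the frontier, as no strict subset of the latter separates.
A vertex `m` of `M` off the frontier would be redundant: a path from `D` whose first vertex in `M`
is `m` avoids the boundary before `m`, so it would join `D` to `m` off the frontier, against `h`. -/
theorem eq_frontier_of_minimal {H : SimpleGraph V} {B D E M : Set V}
    (hM : Disjoint M (B ∪ D)) (hsep : Separates H B D (M ∪ E))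
    (hmin : ∀ M', M' ⊂ M → ¬ Separates H B D (M' ∪ E))
    (h : Separates H D M (frontier H (boundary H B E) D E ∪ E)) :
    M = frontier H (boundary H B E) D E := by
  have hMB : Disjoint M B := hM.mono_right Set.subset_union_left
  refine by_contra fun hne => not_separates_of_ssubset_frontier (M := M) (D := D)
    (lt_of_le_of_ne (fun m hm => ?_) hne) hsep
  by_contra hmF
  have hss : M \ {m} ⊂ M := ⟨Set.sdiff_subset, fun h => (h hm).2 rfl⟩
  have hF : ∀ v, Reach H D (M ∪ E) v → Reach H D (frontier H (boundary H B E) D E ∪ E) v :=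
    fun v hv => hv.enlarge fun w hw hwF => hwF.elim
      (fun h => hw.notMem_boundary hMB hsep h.1) fun h => hw.notMem (.inr h)
  have key : ∀ w, Reach H D (M \ {m} ∪ E) w → Reach H D (M ∪ E) w := by
    intro w hw
    induction hw with
    | start hx hz =>
      refine .start hx fun h' => h'.elim (fun h' => ?_) fun h' => hz (.inr h')
      exact hM.ne_of_mem h' (.inr hx) rfl
    | @step a b _ hab hb ih =>
      refine ih.step hab fun h' => h'.elim (fun h' => ?_) fun h' => hb (.inr h')
      obtain rfl : b = m := by_contra fun hbm => hb (.inl ⟨h', hbm⟩)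
      exact separates_iff.1 h b hm
        ((hF a ih).step hab fun h => h.elim hmF fun h => hb (.inr h))
  exact hmin _ hss (Separates.symm (separates_iff.2 fun b hb hr => hsep.not_reach hb (key b hr)))

end UndirectedBlankets

/-! ### Conditional independence from factorization -/

section Soundness

variable {V : Type u}

open Classical in
/-- The configuration that agrees with `ω` on `A` and with `ω'` off `A`. -/
noncomputable def mix {S : V → Type} (A : Set V) (ω ω' : ∀ v, S v) : ∀ v, S v :=
  fun v => if v ∈ A then ω v else ω' v

theorem mix_of_mem {S : V → Type} {A : Set V} {ω ω' : ∀ v, S v} {v : V} (h : v ∈ A) :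
    mix A ω ω' v = ω v := if_pos h

theorem mix_of_notMem {S : V → Type} {A : Set V} {ω ω' : ∀ v, S v} {v : V} (h : v ∉ A) :
    mix A ω ω' v = ω' v := if_neg h

theorem mix_mix {S : V → Type} (A : Set V) (ω ω' : ∀ v, S v) :
    mix A (mix A ω ω') (mix A ω' ω) = ω := by
  funext v
  by_cases h : v ∈ A
  · simp [mix_of_mem h]
  · simp [mix_of_notMem h]

/-- Exchange of the coordinates off `A` between two configurations. -/
noncomputable def mixEquiv {S : V → Type} (A : Set V) :
    (∀ v, S v) × (∀ v, S v) ≃ (∀ v, S v) × (∀ v, S v) where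
  toFun ω := (mix A ω.1 ω.2, mix A ω.2 ω.1)
  invFun ω := (mix A ω.1 ω.2, mix A ω.2 ω.1)
  left_inv ω := by simp [mix_mix]
  right_inv ω := by simp [mix_mix]

theorem IsAcyclic.exists_sink [Finite V] {G : Digraph V} (hG : IsAcyclic G) {T : Finset V}
    (hT : T.Nonempty) : ∃ v ∈ T, ∀ u ∈ T, ¬ G.Adj v u := by
  let r : V → V → Prop := fun a b => Relation.TransGen G.Adj b a
  have : IsTrans V r := ⟨fun a b c hab hbc => hbc.trans hab⟩
  have : Std.Irrefl r := ⟨hG⟩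
  obtain ⟨v, hv, hmin⟩ := (Finite.wellFounded_of_trans_of_irrefl r).has_min (T : Set V) hT
  exact ⟨v, hv, fun u hu h => hmin u hu (.single h)⟩

variable [Fintype V] [DecidableEq V]

/-- Both sides of the independence identity are sums over pairs of configurations, and the exchange
of the coordinates off `A` maps one sum to the other term by term. -/
theorem condIndep_of_exchange {S : V → Type} [∀ v, Fintype (S v)] {p : (∀ v, S v) → ℝ}
    {A X Y Z : Set V} (hX : X ⊆ A ∪ Z) (hY : Disjoint Y A) (hZ : Disjoint Z A)
    (h : ∀ ω ω' : ∀ v, S v, (∀ v ∈ Z, ω v = ω' v) →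
      p ω * p ω' = p (mix A ω ω') * p (mix A ω' ω)) :
    CondIndep p X Y Z := by
  intro x y z
  simp only [prob, Finset.sum_mul_sum, ← Fintype.sum_prod_type']
  symm
  rw [← Equiv.sum_comp (mixEquiv A)]
  refine Finset.sum_congr rfl fun ω _ => Eq.symm ?_
  obtain ⟨ω, ω'⟩ := ω
  simp only [mixEquiv, Equiv.coe_fn_mk]
  have hY' : ∀ v ∈ Y, v ∉ A := fun v hv => Set.disjoint_left.1 hY hv
  have hZ' : ∀ v ∈ Z, v ∉ A := fun v hv => Set.disjoint_left.1 hZ hv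
  have hiff : (ω ∈ cylinder X x ∩ cylinder Y y ∩ cylinder Z z ∧ ω' ∈ cylinder Z z) ↔
      (mix A ω ω' ∈ cylinder X x ∩ cylinder Z z ∧ mix A ω' ω ∈ cylinder Y y ∩ cylinder Z z) := by
    have e1 : ∀ {a b : ∀ v, S v}, mix A a b ∈ cylinder Z z ↔ b ∈ cylinder Z z := by
      intro a b
      exact forall₂_congr fun v hv => by rw [mix_of_notMem (hZ' v hv)]
    have e2 : mix A ω' ω ∈ cylinder Y y ↔ ω ∈ cylinder Y y :=
      forall₂_congr fun v hv => by rw [mix_of_notMem (hY' v hv)]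
    have e3 : ω ∈ cylinder Z z → ω' ∈ cylinder Z z →
        (mix A ω ω' ∈ cylinder X x ↔ ω ∈ cylinder X x) := by
      intro h1 h2
      refine forall₂_congr fun v hv => ?_
      rcases hX hv with hA | hvZ
      · rw [mix_of_mem hA]
      · rw [mix_of_notMem (hZ' v hvZ), h1 v hvZ, h2 v hvZ]
    simp only [Set.mem_inter_iff, e1, e2]
    tauto
  by_cases hc : ω ∈ cylinder X x ∩ cylinder Y y ∩ cylinder Z z ∧ ω' ∈ cylinder Z z
  · have hc' := hiff.1 hc
    rw [Set.indicator_of_mem hc.1, Set.indicator_of_mem hc.2, Set.indicator_of_mem hc'.1,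
      Set.indicator_of_mem hc'.2]
    exact h ω ω' fun v hv => (hc.1.2 v hv).trans (hc.2 v hv).symm
  · have hc' := fun h => hc (hiff.2 h)
    rw [not_and_or] at hc
    have hc' := not_and_or.1 hc'
    trans (0 : ℝ)
    · rcases hc with hc | hc <;> simp [Set.indicator_of_notMem hc]
    · rcases hc' with hc | hc <;> simp [Set.indicator_of_notMem hc]

/-- A product of functions of cliques of `H` satisfies the global Markov property. -/
theorem Separates.condIndep_prod {H : SimpleGraph V} {S : V → Type} [∀ v, Fintype (S v)]
    {ι : Type*} {s : Finset ι} {f : ι → (∀ v, S v) → ℝ} {F : ι → Set V}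
    (hF : ∀ i ∈ s, H.IsClique (F i)) (hf : ∀ i ∈ s, DependsOn (f i) (F i))
    {X Y Z : Set V} (h : Separates H X Y Z) :
    CondIndep (fun ω => ∏ i ∈ s, f i ω) X Y Z := by
  refine condIndep_of_exchange (A := {a | Reach H X Z a}) ?_ ?_ ?_ ?_
  · intro x hx
    by_cases hxZ : x ∈ Z
    · exact .inr hxZ
    · exact .inl (.start hx hxZ)
  · exact Set.disjoint_left.2 fun y hy => separates_iff.1 h y hy
  · exact Set.disjoint_left.2 fun z hz hr => hr.notMem hz
  · intro ω ω' hω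
    simp only [← Finset.prod_mul_distrib]
    refine Finset.prod_congr rfl fun i hi => ?_
    -- A clique with a reached vertex lies in the reached set and `Z`, so the exchange leaves its
    -- factors unchanged. Any other clique misses the reached set, so its two factors are swapped.
    by_cases hA : ∃ a ∈ F i, Reach H X Z a
    · obtain ⟨a, haF, ha⟩ := hA
      have hsub : ∀ v ∈ F i, Reach H X Z v ∨ v ∈ Z := by
        intro v hv
        by_cases hvZ : v ∈ Z
        · exact .inr hvZ
        by_cases hav : a = v
        · exact .inl (hav ▸ ha)
        · exact .inl (ha.step (hF i hi haF hv hav) hvZ)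
      have key : ∀ {ω ω' : ∀ v, S v}, (∀ v ∈ Z, ω v = ω' v) →
          f i ω = f i (mix {a | Reach H X Z a} ω ω') := by
        intro ω ω' hω
        refine hf i hi fun v hv => ?_
        by_cases hr : Reach H X Z v
        · rw [mix_of_mem (A := {a | Reach H X Z a}) hr]
        · rw [mix_of_notMem (A := {a | Reach H X Z a}) hr, hω v ((hsub v hv).resolve_left hr)]
      rw [key hω, key fun v hv => (hω v hv).symm]
    · push Not at hA
      have key : ∀ ω ω' : ∀ v, S v, f i ω' = f i (mix {a | Reach H X Z a} ω ω') :=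
        fun ω ω' => hf i hi fun v hv =>
          (mix_of_notMem (A := {a | Reach H X Z a}) (hA v hv)).symm
      rw [key ω' ω, key ω ω', mul_comm]

/-- Both sides of the identity are quadratic in `p`, so `c * c` factors out. This covers normalizing
constants, and marginalization to `W`. -/
theorem CondIndep.of_proportional {S : V → Type} [∀ v, Fintype (S v)] {p p' : (∀ v, S v) → ℝ}
    {W X Y Z : Set V} (hX : X ⊆ W) (hY : Y ⊆ W) (hZ : Z ⊆ W) (c : ℝ)
    (h : ∀ A : Set (∀ v, S v), DependsOn (fun ω => ω ∈ A) W → prob p A = c * prob p' A)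
    (hp' : CondIndep p' X Y Z) : CondIndep p X Y Z := by
  intro x y z
  have hcyl : ∀ {X : Set V}, X ⊆ W → ∀ x : ∀ v, S v, DependsOn (fun ω => ω ∈ cylinder X x) W :=
    fun hX x ω ω' hω => propext (forall₂_congr fun v hv => by rw [hω v (hX hv)])
  have hinter : ∀ {A A' : Set (∀ v, S v)}, DependsOn (fun ω => ω ∈ A) W →
      DependsOn (fun ω => ω ∈ A') W → DependsOn (fun ω => ω ∈ A ∩ A') W :=
    fun hA hA' ω ω' hω => congr_arg₂ And (hA hω) (hA' hω)
  rw [h _ (hinter (hinter (hcyl hX x) (hcyl hY y)) (hcyl hZ z)), h _ (hcyl hZ z),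
    h _ (hinter (hcyl hX x) (hcyl hZ z)), h _ (hinter (hcyl hY y) (hcyl hZ z))]
  linear_combination c * c * hp' x y z

theorem Separates.indepUndirected {G : SimpleGraph V} {X Y Z : Set V} (h : Separates G X Y Z) :
    IndepUndirected G X Y Z := by
  rintro S _ p ⟨-, 𝒞, ψ, c, h𝒞, -, hp⟩
  refine CondIndep.of_proportional (Set.subset_univ X) (Set.subset_univ Y) (Set.subset_univ Z)
    (1 / c) (p' := fun x => ∏ C ∈ 𝒞, ψ C (fun v => x v)) (fun A _ => ?_)
    (h.condIndep_prod (ι := Finset V) (F := fun C => (C : Set V)) h𝒞 fun C _ ω ω' hω => ?_)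
  · rw [prob, prob, Finset.mul_sum]
    refine Finset.sum_congr rfl fun ω _ => ?_
    by_cases hω : ω ∈ A
    · rw [Set.indicator_of_mem hω, Set.indicator_of_mem hω, hp]
    · rw [Set.indicator_of_notMem hω, Set.indicator_of_notMem hω, mul_zero]
  · exact congr_arg (ψ C) (funext fun v => hω v v.2)

/-- Summing out `v` without splitting off its coordinate: swap it with an auxiliary value `s`. The
cardinality appears because `F` is still summed over all values at `v`. -/
theorem card_mul_sum_mul {S : V → Type} [∀ v, Fintype (S v)] (v : V) {F g : (∀ v, S v) → ℝ}
    (hF : ∀ ω s, F (Function.update ω v s) = F ω)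
    (hg : ∀ ω, ∑ s, g (Function.update ω v s) = 1) :
    Fintype.card (S v) * ∑ ω, F ω * g ω = ∑ ω, F ω := by
  let e : (∀ v, S v) × S v ≃ (∀ v, S v) × S v :=
    { toFun := fun a => (Function.update a.1 v a.2, a.1 v)
      invFun := fun a => (Function.update a.1 v a.2, a.1 v)
      left_inv := fun a => by simp
      right_inv := fun a => by simp }
  calc (Fintype.card (S v) : ℝ) * ∑ ω, F ω * g ω = ∑ ω, ∑ _s : S v, F ω * g ω := by
        simp [Finset.mul_sum]
    _ = ∑ a : (∀ v, S v) × S v, F a.1 * g a.1 :=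
        (Fintype.sum_prod_type fun a : (∀ v, S v) × S v => F a.1 * g a.1).symm
    _ = ∑ a : (∀ v, S v) × S v, F (e a).1 * g (e a).1 := (Equiv.sum_comp e fun a => F a.1 * g a.1).symm
    _ = ∑ ω, ∑ s, F ω * g (Function.update ω v s) := by
        rw [Fintype.sum_prod_type]; simp [e, hF]
    _ = ∑ ω, F ω := by simp [← Finset.mul_sum, hg]

/-- In a product of conditional distributions, the vertices of a set without children outside
that set can be summed out. -/
theorem sum_prod_conditional {G : Digraph V} (hG : IsAcyclic G) {S : V → Type}
    [∀ v, Fintype (S v)] {q : ∀ v : V, (∀ u : {u : V // G.Adj u v}, S u) → S v → ℝ}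
    (hq : ∀ v xpa, q v xpa ∈ stdSimplex ℝ (S v)) {W : Finset V}
    (hW : ∀ u, ∀ v ∈ W, G.Adj u v → u ∈ W) {A : Set (∀ v, S v)}
    (hA : DependsOn (fun ω => ω ∈ A) (W : Set V)) (T : Finset V) (hT : Disjoint T W) :
    (∏ v ∈ T, (Fintype.card (S v) : ℝ)) *
      prob (fun ω => ∏ v ∈ W ∪ T, q v (fun u => ω u) (ω v)) A =
      prob (fun ω => ∏ v ∈ W, q v (fun u => ω u) (ω v)) A := by
  induction T using Finset.strongInduction with
  | H T ih =>
  rcases T.eq_empty_or_nonempty with rfl | hne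
  · simp
  -- A sink of `T` has no child in `W ∪ T`, so its coordinate enters no factor but its own.
  obtain ⟨v, hvT, hv⟩ := hG.exists_sink hne
  have hvW : v ∉ W := Finset.disjoint_left.1 hT hvT
  have hvL : v ∉ W ∪ T.erase v := by simp [hvW]
  have hL : W ∪ T = insert v (W ∪ T.erase v) := by
    rw [← Finset.union_insert, Finset.insert_erase hvT]
  rw [← ih (T.erase v) (Finset.erase_ssubset hvT) (hT.mono_left (Finset.erase_subset _ _)),
    ← Finset.prod_erase_mul _ _ hvT, mul_assoc]
  congr 1
  let F : (∀ v, S v) → ℝ :=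
    A.indicator fun ω => ∏ w ∈ W ∪ T.erase v, q w (fun u => ω u) (ω w)
  rw [prob, prob, ← card_mul_sum_mul v (F := F) (g := fun ω => q v (fun u => ω u) (ω v))]
  · congr 1
    refine Finset.sum_congr rfl fun ω _ => ?_
    by_cases hω : ω ∈ A
    · simp only [F, Set.indicator_of_mem hω]
      rw [hL, Finset.prod_insert hvL, mul_comm]
    · simp [F, Set.indicator_of_notMem hω]
  · intro ω s
    have hAω : Function.update ω v s ∈ A ↔ ω ∈ A := by
      refine iff_of_eq (hA fun w hw => Function.update_of_ne ?_ _ _)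
      rintro rfl
      exact hvW hw
    by_cases hω : ω ∈ A
    · simp only [F, Set.indicator_of_mem hω, Set.indicator_of_mem (hAω.2 hω)]
      refine Finset.prod_congr rfl fun w hw => ?_
      have hwv : w ≠ v := fun h => hvL (h ▸ hw)
      rw [Function.update_of_ne hwv]
      congr 1
      funext u
      refine Function.update_of_ne ?_ _ _
      rintro huv
      rcases Finset.mem_union.1 hw with hw | hw
      · exact hvW (hW v w hw (huv ▸ u.2))
      · exact hv w (Finset.mem_of_mem_erase hw) (huv ▸ u.2)
    · simp only [F, Set.indicator_of_notMem hω, Set.indicator_of_notMem fun h => hω (hAω.1 h)]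
  · intro ω
    rw [← (hq v fun u => ω u).2]
    refine Finset.sum_congr rfl fun s _ => ?_
    rw [Function.update_self]
    congr 1
    funext u
    exact Function.update_of_ne (hG.ne_of_adj u.2) _ _

/-- Summing out the vertices off the ancestral set leaves factors on a vertex and its parents, which
form a clique of the moral graph. -/
theorem Separates.indepDirected {G : Digraph V} (hG : IsAcyclic G) {X Y Z : Set V}
    (h : Separates (moralGraph G (ascendantsWithSelf G (X ∪ Y ∪ Z))) X Y Z) :
    IndepDirected G X Y Z := by
  classical
  rintro S _ p ⟨hp, q, hq, hpq⟩
  set W : Set V := ascendantsWithSelf G (X ∪ Y ∪ Z) with hWdef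
  have hsub : X ∪ Y ∪ Z ⊆ W := subset_ascendantsWithSelf G _
  have hΩ : Nonempty (∀ v, S v) := by
    by_contra hne
    rw [not_nonempty_iff] at hne
    simpa using hp.2
  have hcard : ∏ v ∈ W.toFinsetᶜ, (Fintype.card (S v) : ℝ) ≠ 0 := by
    refine Finset.prod_ne_zero_iff.2 fun v _ => ?_
    have : Nonempty (S v) := hΩ.map fun ω => ω v
    exact_mod_cast Fintype.card_ne_zero
  refine CondIndep.of_proportional (W := W) (fun x hx => hsub (.inl (.inl hx)))
    (fun x hx => hsub (.inl (.inr hx))) (fun x hx => hsub (.inr hx))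
    (∏ v ∈ W.toFinsetᶜ, (Fintype.card (S v) : ℝ))⁻¹
    (p' := fun ω => ∏ v ∈ W.toFinset, q v (fun u => ω u) (ω v)) (fun A hA => ?_)
    (h.condIndep_prod (F := fun v => insert v {u | G.Adj u v}) (fun v hv => ?_)
      fun v _ ω ω' hω => ?_)
  · rw [← sum_prod_conditional hG hq (W := W.toFinset) (T := W.toFinsetᶜ) ?_ ?_ ?_,
      inv_mul_cancel_left₀ hcard, Finset.union_compl]
    · exact congr_arg (fun p => prob p A) (funext hpq)
    · intro u v hv huv
      rw [Set.mem_toFinset] at hv ⊢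
      exact mem_ascendantsWithSelf_of_adj huv hv
    · simpa using hA
    · exact disjoint_compl_left
  · have hv : v ∈ W := Set.mem_toFinset.1 hv
    rintro a (rfl | ha) b (rfl | hb) hab
    · exact absurd rfl hab
    · exact (moralGraph_adj_of_adj hG hb hv).symm
    · exact moralGraph_adj_of_adj hG ha hv
    · exact ⟨hab, mem_ascendantsWithSelf_of_adj ha hv, mem_ascendantsWithSelf_of_adj hb hv,
        .inr (.inr ⟨v, hv, ha, hb⟩)⟩
  · rw [hω v (.inl rfl)]
    congr 1
    funext u
    exact hω u (.inr u.2)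

end Soundness

/-! ### Distributions without conditional independence -/

section Completeness

variable {V : Type u} [Fintype V] [DecidableEq V]

theorem prob_pos {S : V → Type} [∀ v, Fintype (S v)] {p : (∀ v, S v) → ℝ} (hp : ∀ ω, 0 ≤ p ω)
    {A : Set (∀ v, S v)} {ω : ∀ v, S v} (hω : ω ∈ A) (h : 0 < p ω) : 0 < prob p A :=
  Finset.sum_pos' (fun _ _ => Set.indicator_nonneg (fun ω _ => hp ω) _)
    ⟨ω, Finset.mem_univ _, by rwa [Set.indicator_of_mem hω]⟩

/-- Two possible configurations that agree on `Z`, the first at `x` being incompatible with the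
second at `y`, exclude independence given `Z`. -/
theorem not_condIndep {S : V → Type} [∀ v, Fintype (S v)] {p : (∀ v, S v) → ℝ}
    (hp : ∀ ω, 0 ≤ p ω) {X Y Z : Set V} {x y : V} (hx : x ∈ X) (hy : y ∈ Y) {ω₁ ω₂ : ∀ v, S v}
    (h₁ : 0 < p ω₁) (h₂ : 0 < p ω₂) (hZ : ∀ v ∈ Z, ω₂ v = ω₁ v)
    (h : ∀ ω, 0 < p ω → ω x = ω₁ x → (∀ v ∈ Z, ω v = ω₁ v) → ω y ≠ ω₂ y) :
    ¬ CondIndep p X Y Z := by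
  intro hc
  have h0 : prob p (cylinder X ω₁ ∩ cylinder Y ω₂ ∩ cylinder Z ω₁) = 0 := by
    refine Finset.sum_eq_zero fun ω _ => ?_
    by_cases hω : ω ∈ cylinder X ω₁ ∩ cylinder Y ω₂ ∩ cylinder Z ω₁
    · rw [Set.indicator_of_mem hω]
      by_contra hne
      exact h ω (lt_of_le_of_ne (hp ω) (Ne.symm hne)) (hω.1.1 x hx) hω.2 (hω.1.2 y hy)
    · rw [Set.indicator_of_notMem hω]
  have := hc ω₁ ω₂ ω₁
  rw [h0, zero_mul] at this
  refine (mul_pos (prob_pos hp (ω := ω₁) ?_ h₁) (prob_pos hp (ω := ω₂) ?_ h₂)).ne this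
  · exact ⟨fun _ _ => rfl, fun _ _ => rfl⟩
  · exact ⟨fun _ _ => rfl, hZ⟩

/-- A distribution of binary variables that factorizes on `G`, under which neighbours outside `Z`
take the same value and every configuration with this property is possible. -/
theorem exists_factorizesUndirected (G : SimpleGraph V) (Z : Set V) :
    ∃ p : (∀ _ : V, Bool) → ℝ, FactorizesUndirected G p ∧
      ∀ ω, 0 < p ω ↔ ∀ a b, G.Adj a b → a ∉ Z → b ∉ Z → ω a = ω b := by
  classical
  let ψ : ∀ C : Finset V, (∀ _ : C, Bool) → ℝ := fun C ω =>
    if ∀ u v : C, (u : V) ∉ Z → (v : V) ∉ Z → ω u = ω v then 1 else 0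
  have hψ : ∀ C ω, 0 ≤ ψ C ω := fun C ω => by dsimp only [ψ]; split_ifs <;> norm_num
  obtain ⟨𝒞, h𝒞⟩ : ∃ 𝒞 : Finset (Finset V), ∀ C, C ∈ 𝒞 ↔ G.IsClique (C : Set V) :=
    ⟨Finset.univ.filter fun C => G.IsClique (C : Set V), by simp⟩
  obtain ⟨f, hfdef⟩ : ∃ f : (∀ _ : V, Bool) → ℝ, ∀ ω, f ω = ∏ C ∈ 𝒞, ψ C fun v => ω v :=
    ⟨_, fun _ => rfl⟩
  have hf : ∀ ω, 0 ≤ f ω := fun ω => hfdef ω ▸ Finset.prod_nonneg fun C _ => hψ C _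
  have hpos : ∀ ω, 0 < f ω ↔ ∀ a b, G.Adj a b → a ∉ Z → b ∉ Z → ω a = ω b := by
    intro ω
    rw [hfdef]
    constructor
    · intro hω a b hab ha hb
      by_contra hne
      refine hω.ne' (Finset.prod_eq_zero (i := {a, b}) ?_ (if_neg fun h => hne ?_))
      · rw [h𝒞, Finset.coe_pair]
        exact SimpleGraph.isClique_pair.2 fun _ => hab
      · exact h ⟨a, by simp⟩ ⟨b, by simp⟩ ha hb
    · intro h
      refine Finset.prod_pos fun C hC => ?_
      have : ψ C (fun v => ω v) = 1 := by
        refine if_pos fun u v hu hv => ?_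
        by_cases huv : (u : V) = v
        · exact congr_arg ω huv
        · exact h u v ((h𝒞 C).1 hC u.2 v.2 huv) hu hv
      rw [this]
      exact one_pos
  have hc : 0 < ∑ ω, f ω :=
    Finset.sum_pos' (fun ω _ => hf ω) ⟨fun _ => false, by simp, (hpos _).2 fun _ _ _ _ _ => rfl⟩
  refine ⟨fun ω => 1 / (∑ ω, f ω) * f ω,
    ⟨⟨fun ω => mul_nonneg (one_div_pos.2 hc).le (hf ω), ?_⟩, 𝒞, ψ, ∑ ω, f ω,
      fun C hC => (h𝒞 C).1 hC, hψ, fun ω => congr_arg _ (hfdef ω)⟩, fun ω => ?_⟩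
  · rw [← Finset.mul_sum]
    exact one_div_mul_cancel hc.ne'
  · rw [← hpos, mul_pos_iff_of_pos_left (one_div_pos.2 hc)]

/-- Along a path avoiding `Z` the value is constant, while both the zero configuration and the
indicator of the complement of `Z` are possible and agree on `Z`. -/
theorem IndepUndirected.separates {G : SimpleGraph V} {X Y Z : Set V}
    (h : IndepUndirected G X Y Z) : Separates G X Y Z := by
  classical
  refine separates_iff.2 fun y hy hr => ?_
  obtain ⟨x, hx, P, hP⟩ := hr.exists_walk
  obtain ⟨p, hp, hpos⟩ := exists_factorizesUndirected G Z
  refine not_condIndep hp.1.1 hx hy (ω₁ := fun _ => false) (ω₂ := fun v => decide (v ∉ Z))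
    ((hpos _).2 fun _ _ _ _ _ => rfl) ((hpos _).2 fun a b _ ha hb => by simp [ha, hb])
    (fun v hv => by simp [hv]) ?_ (h _ p hp)
  intro ω hω hωx _ hωy
  have key : ∀ {a b : V} (P : G.Walk a b), (∀ w ∈ P.support, w ∉ Z) → ω a = ω b := by
    intro a b P hP
    induction P with
    | nil => rfl
    | cons hab P ih =>
      exact ((hpos ω).1 hω _ _ hab (hP _ (by simp)) (hP _ (by simp))).trans
        (ih fun w hw => hP w (by simp [hw]))
  have := key P hP
  simp [hωx, hωy, hr.notMem] at this

theorem indepUndirected_iff {G : SimpleGraph V} {X Y Z : Set V} :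
    IndepUndirected G X Y Z ↔ Separates G X Y Z :=
  ⟨IndepUndirected.separates, Separates.indepUndirected⟩

/-- A distribution that factorizes on `G`, with prescribed sets of possible values given the
parents. -/
theorem IsAcyclic.exists_factorizesDirected {G : Digraph V} (hG : IsAcyclic G) {S : V → Type}
    [∀ v, Fintype (S v)] [∀ v, Nonempty (S v)] (R : ∀ v : V, (∀ u : {u : V // G.Adj u v}, S u) → S v → Prop)
    (hR : ∀ v xpa, ∃ s, R v xpa s) :
    ∃ p : (∀ v, S v) → ℝ, FactorizesDirected G p ∧
      ∀ ω, 0 < p ω ↔ ∀ v, R v (fun u => ω u) (ω v) := by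
  classical
  let n : ∀ v : V, (∀ u : {u : V // G.Adj u v}, S u) → ℕ := fun v xpa =>
    (Finset.univ.filter (R v xpa)).card
  have hn : ∀ v xpa, (0 : ℝ) < n v xpa := fun v xpa => by
    obtain ⟨s, hs⟩ := hR v xpa
    exact_mod_cast Finset.card_pos.2 ⟨s, by simpa using hs⟩
  let q : ∀ v : V, (∀ u : {u : V // G.Adj u v}, S u) → S v → ℝ := fun v xpa s =>
    if R v xpa s then (n v xpa : ℝ)⁻¹ else 0
  have hq0 : ∀ v xpa s, 0 ≤ q v xpa s := fun v xpa s => by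
    dsimp only [q]
    split_ifs
    · exact (inv_pos.2 (hn v xpa)).le
    · exact le_rfl
  have hq : ∀ v xpa, q v xpa ∈ stdSimplex ℝ (S v) := fun v xpa => by
    refine ⟨hq0 v xpa, ?_⟩
    simp only [q, ← Finset.sum_filter, Finset.sum_const, nsmul_eq_mul]
    exact mul_inv_cancel₀ (hn v xpa).ne'
  refine ⟨fun ω => ∏ v, q v (fun u => ω u) (ω v),
    ⟨⟨fun ω => Finset.prod_nonneg fun v _ => hq0 _ _ _, ?_⟩, q, hq, fun _ => rfl⟩, fun ω => ?_⟩
  -- Total mass one: all vertices are summed out, and the number of configurations cancels.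
  · have hsum := sum_prod_conditional hG hq (W := ∅) (by simp) (A := Set.univ)
      (fun _ _ _ => rfl) Finset.univ (by simp)
    simp only [prob, Set.indicator_univ, Finset.empty_union, Finset.prod_empty, Finset.sum_const,
      Finset.card_univ, Fintype.card_pi, nsmul_eq_mul, mul_one, Nat.cast_prod] at hsum
    refine mul_left_cancel₀ ?_ (hsum.trans (mul_one _).symm)
    exact Finset.prod_ne_zero_iff.2 fun v _ => by exact_mod_cast Fintype.card_ne_zero
  · constructor
    · intro h v
      by_contra hv
      exact h.ne' (Finset.prod_eq_zero (Finset.mem_univ v) (if_neg hv))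
    · intro h
      refine Finset.prod_pos fun v _ => ?_
      simp only [q, if_pos (h v)]
      exact inv_pos.2 (hn _ _)

/-- The value at position `i` of a configuration of a vertex; it is `false` beyond the end. -/
def bit {k : ℕ} (s : Fin (k + 1) → Bool) (i : ℕ) : Bool :=
  if h : i < k + 1 then s ⟨i, h⟩ else false

theorem bit_eq {k : ℕ} (s : Fin (k + 1) → Bool) {i : ℕ} (h : i < k + 1) : bit s i = s ⟨i, h⟩ :=
  dif_pos h

open Classical in
/-- The value at position `i` of the configuration of `u`, if `u` is a parent of `v`. -/
noncomputable def parentBit {G : Digraph V} {k : ℕ} {v : V}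
    (xpa : ∀ _ : {u : V // G.Adj u v}, Fin (k + 1) → Bool) (u : V) (i : ℕ) : Bool :=
  if h : G.Adj u v then bit (xpa ⟨u, h⟩) i else false

open Classical in
/-- The value transmitted to position `i` at `v` by the parents of `v`: along the trail `P`, and
from its v-structures to their descendants. -/
noncomputable def transmitted (G : Digraph V) (k : ℕ) (P : ℕ → V) (v : V)
    (xpa : ∀ _ : {u : V // G.Adj u v}, Fin (k + 1) → Bool) (i : ℕ) : Bool :=
  if v = P i then xor (parentBit xpa (P (i - 1)) (i - 1)) (parentBit xpa (P (i + 1)) (i + 1))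
  else decide (IsVStructure G k P i ∧ ∃ u, parentBit xpa u i = true)

/-- An arc of the trail `P 0, …, P k` enters its `i`-th vertex. -/
def HasEntry (G : Digraph V) (k : ℕ) (P : ℕ → V) (i : ℕ) : Prop :=
  0 < i ∧ G.Adj (P (i - 1)) (P i) ∨ i < k ∧ G.Adj (P (i + 1)) (P i)

/-- The possible values of a vertex: those transmitted by its parents, and arbitrary values at the
positions of the trail that no arc enters. -/
def TransmissionRule (G : Digraph V) (k : ℕ) (P : ℕ → V) (v : V)
    (xpa : ∀ _ : {u : V // G.Adj u v}, Fin (k + 1) → Bool) (s : Fin (k + 1) → Bool) : Prop :=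
  ∀ i : Fin (k + 1), (v = P i → HasEntry G k P i) → s i = transmitted G k P v xpa i

/-- Each vertex carries one bit per position of an active trail, since the trail may repeat
vertices. At its own position a vertex entered by an arc of the trail holds the sum mod 2 of the
incoming bits, and a v-structure passes its bit on to all its descendants. Zeros on `Z` thus force
equal bits on both sides of a v-structure, and a zero at `x` propagates to `y`. The configuration
`ω₂`, with ones exactly at the positions that are not v-structures, is possible too and vanishes on
`Z`. -/
theorem DSeparates.of_indepDirected {G : Digraph V} (hG : IsAcyclic G) {X Y Z : Set V}
    (h : IndepDirected G X Y Z) : DSeparates G X Y Z := by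
  classical
  intro x hx y hy k P hP hact
  obtain ⟨p, hp, hpos⟩ := hG.exists_factorizesDirected (S := fun _ => Fin (k + 1) → Bool)
    (TransmissionRule G k P) fun v xpa => ⟨fun i => transmitted G k P v xpa i, fun _ _ => rfl⟩
  have hend : ∀ i, i = 0 ∨ i = k → ¬ IsVStructure G k P i := fun i hi h => by
    have := h.1; have := h.2.1; omega
  have hpar : ∀ (ω : V → Fin (k + 1) → Bool) (v u : V) (i : ℕ),
      parentBit (G := G) (v := v) (fun w => ω w) u i = true ↔
        G.Adj u v ∧ bit (ω u) i = true := by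
    intro ω v u i
    by_cases huv : G.Adj u v <;> simp [parentBit, huv]
  let ω₂ : V → Fin (k + 1) → Bool := fun v i => decide (v = P i ∧ ¬ IsVStructure G k P i)
  have hω₂ : ∀ v i, bit (ω₂ v) i = true ↔ i ≤ k ∧ v = P i ∧ ¬ IsVStructure G k P i := by
    intro v i
    by_cases hi : i < k + 1
    · simp [bit_eq _ hi, ω₂, Nat.lt_succ_iff.1 hi]
    · simp only [bit, dif_neg hi]
      simp; omega
  refine not_condIndep (x := x) (y := y) (ω₁ := fun _ _ => false) (ω₂ := ω₂) hp.1.1 hx hy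
    ((hpos _).2 ?_) ((hpos _).2 ?_) ?_ ?_ (h _ p hp)
  · intro v i _
    have h0 : ∀ u j, parentBit (G := G) (v := v) (fun _ _ => false : _ → Fin (k + 1) → Bool) u j
        = false := by
      intro u j
      simp [parentBit, bit]
    simp [transmitted, h0]
  · intro v ⟨i, hi⟩ hfree
    rw [Bool.eq_iff_iff, ← bit_eq (ω₂ v) hi, hω₂]
    simp only at hfree
    by_cases hv : v = P i
    · subst hv
      have hl : parentBit (G := G) (v := P i) (fun w => ω₂ w) (P (i - 1)) (i - 1) = true ↔
          0 < i ∧ G.Adj (P (i - 1)) (P i) := by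
        rw [hpar, hω₂]
        constructor
        · rintro ⟨h1, -⟩
          refine ⟨Nat.pos_of_ne_zero ?_, h1⟩
          rintro rfl
          exact hG.ne_of_adj h1 rfl
        · rintro ⟨h0, h1⟩
          refine ⟨h1, by omega, rfl, fun h => hG.asymm h1 ?_⟩
          have := h.2.2.2
          rwa [Nat.sub_add_cancel h0] at this
      have hr : parentBit (G := G) (v := P i) (fun w => ω₂ w) (P (i + 1)) (i + 1) = true ↔
          i < k ∧ G.Adj (P (i + 1)) (P i) := by
        rw [hpar, hω₂]
        constructor
        · rintro ⟨h1, h2, -⟩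
          exact ⟨h2, h1⟩
        · rintro ⟨h0, h1⟩
          exact ⟨h1, h0, rfl, fun h => hG.asymm h1 h.2.2.1⟩
      have hf := hfree rfl
      have hV : IsVStructure G k P i ↔ (0 < i ∧ G.Adj (P (i - 1)) (P i)) ∧
          (i < k ∧ G.Adj (P (i + 1)) (P i)) := by
        simp only [IsVStructure]; tauto
      rw [HasEntry, ← hl, ← hr] at hf
      rw [← hl, ← hr] at hV
      simp only [transmitted, if_true, hV, Nat.lt_succ_iff.1 hi, true_and]
      revert hf
      cases parentBit (G := G) (v := P i) (fun w => ω₂ w) (P (i - 1)) (i - 1) <;>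
      cases parentBit (G := G) (v := P i) (fun w => ω₂ w) (P (i + 1)) (i + 1) <;> simp
    · simp only [transmitted, hv, if_false, false_and, and_false, false_iff, decide_eq_true_eq]
      rintro ⟨h1, u, hu⟩
      exact ((hω₂ _ _).1 ((hpar _ _ _ _).1 hu).2).2.2 h1
  · intro v hv
    funext i
    simp only [ω₂, decide_eq_false_iff_not]
    rintro ⟨rfl, hi⟩
    exact (hact i (Nat.lt_succ_iff.1 i.2)).1 hi hv
  · intro ω hω hωx hωZ hωy
    have hrule := (hpos ω).1 hω
    have hin : ∀ i ≤ k, HasEntry G k P i → bit (ω (P i)) i =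
        xor (parentBit (G := G) (v := P i) (fun w => ω w) (P (i - 1)) (i - 1))
          (parentBit (G := G) (v := P i) (fun w => ω w) (P (i + 1)) (i + 1)) := by
      intro i hi hent
      rw [bit_eq _ (Nat.lt_succ_iff.2 hi), hrule (P i) ⟨i, Nat.lt_succ_iff.2 hi⟩ fun _ => hent]
      simp [transmitted]
    have hdesc : ∀ i ≤ k, IsVStructure G k P i → bit (ω (P i)) i = true →
        ∀ d, Relation.ReflTransGen G.Adj (P i) d → bit (ω d) i = true := by
      intro i hi hV hb d hd
      induction hd with
      | refl => exact hb
      | @tail d e hd hde ih =>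
        have hne : e ≠ P i := by
          rintro rfl
          exact hG _ (Relation.TransGen.tail' hd hde)
        rw [bit_eq _ (Nat.lt_succ_iff.2 hi),
          hrule e ⟨i, Nat.lt_succ_iff.2 hi⟩ fun h => absurd h hne]
        simp only [transmitted, hne, if_false, decide_eq_true_eq]
        exact ⟨hV, d, (hpar _ _ _ _).2 ⟨hde, ih⟩⟩
    have hcol : ∀ i ≤ k, IsVStructure G k P i → bit (ω (P i)) i = false := by
      intro i hi hV
      obtain ⟨z, hz, hzZ⟩ := (hact i hi).2 hV
      by_contra hb
      have := hdesc i hi hV (by simpa using hb) z hz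
      rw [hωZ z hzZ] at this
      simp [bit] at this
    have hadj : ∀ {v u : V} {i : ℕ}, G.Adj u v →
        parentBit (G := G) (v := v) (fun w => ω w) u i = bit (ω u) i := fun h => dif_pos h
    have hnadj : ∀ {v u : V} {i : ℕ}, ¬ G.Adj u v →
        parentBit (G := G) (v := v) (fun w => ω w) u i = false := fun h => dif_neg h
    -- At the ends the missing neighbour contributes `false`: at `0` truncated subtraction gives the
    -- vertex itself, which is not its own parent, and `bit` is `false` at `k + 1`.
    have key : ∀ i ≤ k, bit (ω (P i)) i = false := by
      intro i
      induction i using Nat.strong_induction_on with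
      | _ i ih =>
      intro hi
      by_cases hV : IsVStructure G k P i
      · exact hcol i hi hV
      obtain _ | i := i
      · rw [hP.1, hωx]; simp [bit]
      have hi' := ih i (by omega) (by omega)
      rcases hP.2.2 i (by omega) with h1 | h1
      · rw [hin (i + 1) hi (.inl ⟨by omega, h1⟩), Nat.add_sub_cancel, hadj h1, hi',
          Bool.false_xor]
        by_cases h2 : G.Adj (P (i + 1 + 1)) (P (i + 1))
        · rw [hadj h2, bit, dif_neg]
          exact fun h => hV ⟨by omega, by omega, h1, h2⟩
        · exact hnadj h2
      · have hi2 := hin i (by omega) (.inr ⟨by omega, h1⟩)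
        rw [hi', hadj h1] at hi2
        suffices parentBit (G := G) (v := P i) (fun w => ω w) (P (i - 1)) (i - 1) = false by
          rw [this, Bool.false_xor] at hi2
          exact hi2.symm
        by_cases h2 : G.Adj (P (i - 1)) (P i)
        · rw [hadj h2]
          exact ih (i - 1) (by omega) (by omega)
        · exact hnadj h2
    have hk := key k le_rfl
    rw [hP.2.1, hωy, ← Bool.not_eq_true, hω₂] at hk
    exact hk ⟨le_rfl, hP.2.1.symm, hend k (.inr rfl)⟩

theorem indepDirected_iff {G : Digraph V} (hG : IsAcyclic G) {X Y Z : Set V} :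
    IndepDirected G X Y Z ↔ DSeparates G X Y Z :=
  ⟨.of_indepDirected hG, fun h => ((dSeparates_iff hG).1 h).indepDirected hG⟩

end Completeness

/-! ### Directional Markov blankets -/

section DirectionalBlankets

variable {V : Type u}

theorem isDirectionalMarkovBlanket_frontier {G : SimpleGraph V} {B D E S : Set V}
    (hS : IsSeparator (Separates G) B D E S) :
    IsDirectionalMarkovBlanket (Separates G) B D E (frontier G (boundary G B E) D E) := by
  have hND := disjoint_boundary_of_separates hS.1 hS.2
  refine ⟨⟨⟨Set.disjoint_union_right.2 ⟨?_, ?_⟩, separates_frontier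
    (inter_subset_of_separates hS.1 hS.2) hND⟩,
    fun M' h => not_separates_of_ssubset_frontier h⟩, fun M' hM' =>
      separates_frontier_of_separates le_rfl (hM'.1.mono_right Set.subset_union_left) hM'.2⟩
  · exact Set.disjoint_left.2 fun x hx => hx.1.1
  · exact hND.mono_left fun x hx => hx.1

/-- Intersection with the ascendants of `B ∪ D ∪ E` preserves d-separators. -/
theorem separates_inter_ascendants {G : Digraph V} (hG : IsAcyclic G) {B D E M : Set V}
    (h : DSeparates G B D (M ∪ E)) :
    Separates (moralGraph G (ascendantsWithSelf G (B ∪ D ∪ E))) B D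
      (M ∩ ascendantsWithSelf G (B ∪ D ∪ E) ∪ E) := by
  rw [dSeparates_iff hG] at h
  have hE := subset_ascendantsWithSelf G (B ∪ D ∪ E)
  refine separates_iff.2 fun d hd hr => separates_iff.1 h d hd ?_
  refine Reach.mono (H := moralGraph G (ascendantsWithSelf G (B ∪ D ∪ E))) (Z := M ∪ E) ?_
    subset_rfl ?_
  · exact moralGraph_mono G (ascendantsWithSelf_mono G
      (Set.union_subset_union_right _ Set.subset_union_right))
  · refine hr.enlarge fun w hw hwM => hw.notMem (hwM.imp_left fun hwM => ⟨hwM, ?_⟩)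
    cases hw with
    | start hx _ => exact hE (.inl (.inl hx))
    | step _ h _ => exact h.2.2.1

theorem ascendantsWithSelf_union_eq {G : Digraph V} {B D E M : Set V}
    (hM : M ⊆ ascendantsWithSelf G (B ∪ D ∪ E)) :
    ascendantsWithSelf G (B ∪ D ∪ (M ∪ E)) = ascendantsWithSelf G (B ∪ D ∪ E) := by
  refine Set.Subset.antisymm (ascendantsWithSelf_subset ?_)
    (ascendantsWithSelf_mono G (Set.union_subset_union_right _ Set.subset_union_right))
  have h := subset_ascendantsWithSelf G (B ∪ D ∪ E)
  rintro x (hx | hx | hx)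
  · exact h (.inl hx)
  · exact hM hx
  · exact h (.inr hx)

theorem dSeparates_iff_of_subset {G : Digraph V} (hG : IsAcyclic G) {B D E M : Set V}
    (hM : M ⊆ ascendantsWithSelf G (B ∪ D ∪ E)) :
    DSeparates G B D (M ∪ E) ↔
      Separates (moralGraph G (ascendantsWithSelf G (B ∪ D ∪ E))) B D (M ∪ E) := by
  rw [dSeparates_iff hG, ascendantsWithSelf_union_eq hM]

theorem boundary_moralGraph_subset {G : Digraph V} {W B E : Set V} :
    boundary (moralGraph G W) B E ⊆ W := by
  rintro w ⟨-, -, b, -, -, hbw⟩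
  exact hbw.2.2.1

theorem frontier_subset {H : SimpleGraph V} {N D E : Set V} : frontier H N D E ⊆ N :=
  fun _ h => h.1

/-- The frontier of a d-separating set does not depend on the ascendants of `B`. -/
theorem frontier_moralGraph_eq {G : Digraph V} (hG : IsAcyclic G) {B D E N : Set V}
    (hN : N ⊆ ascendantsWithSelf G (B ∪ D ∪ E))
    (hsep : Separates (moralGraph G (ascendantsWithSelf G (B ∪ D ∪ E))) D B (N ∪ E)) :
    frontier (moralGraph G (ascendantsWithSelf G (D ∪ N ∪ E))) N D E =
      frontier (moralGraph G (ascendantsWithSelf G (B ∪ D ∪ E))) N D E := by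
  have hsub := subset_ascendantsWithSelf G (D ∪ N ∪ E)
  have hdiff : B ∪ D ∪ E ⊆ B ∪ ascendantsWithSelf G (D ∪ N ∪ E) := by
    rintro x ((hx | hx) | hx)
    · exact .inl hx
    · exact .inr (hsub (.inl (.inl hx)))
    · exact .inr (hsub (.inr hx))
  have hle : moralGraph G (ascendantsWithSelf G (D ∪ N ∪ E)) ≤
      moralGraph G (ascendantsWithSelf G (B ∪ D ∪ E)) := by
    refine moralGraph_mono G (ascendantsWithSelf_subset ?_)
    have h := subset_ascendantsWithSelf G (B ∪ D ∪ E)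
    rintro x ((hx | hx) | hx)
    · exact h (.inl (.inr hx))
    · exact hN hx
    · exact h (.inr hx)
  have hD : D ⊆ D ∪ N ∪ E := fun x hx => .inl (.inl hx)
  have hZ : N ∪ E ⊆ D ∪ N ∪ E := fun x hx => hx.elim (fun h => .inl (.inr h)) .inr
  ext n
  constructor
  · rintro ⟨hn, u, hu, hun⟩
    exact ⟨hn, u, hu.mono hle subset_rfl, hle hun⟩
  · rintro ⟨hn, u, hu, hun⟩
    exact ⟨hn, u, hu.restrict hG hdiff hD hZ hsep,
      hu.moralGraph_adj hG hdiff hD hZ hsep (hsub (.inl (.inr hn))) hun⟩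

theorem isDirectionalMarkovBlanket_moral_frontier {G : Digraph V} (hG : IsAcyclic G)
    {B D E S : Set V} (hS : IsSeparator (DSeparates G) B D E S) {H : SimpleGraph V}
    (hH : H = moralGraph G (ascendantsWithSelf G (B ∪ D ∪ E))) :
    IsDirectionalMarkovBlanket (DSeparates G) B D E (frontier H (boundary H B E) D E) := by
  subst hH
  have hS' : IsSeparator (Separates (moralGraph G (ascendantsWithSelf G (B ∪ D ∪ E)))) B D E
      (S ∩ ascendantsWithSelf G (B ∪ D ∪ E)) :=
    ⟨hS.1.mono_left Set.inter_subset_left, separates_inter_ascendants hG hS.2⟩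
  obtain ⟨⟨⟨hdisj, hsep⟩, hmin⟩, -⟩ := isDirectionalMarkovBlanket_frontier hS'
  have hsub := (frontier_subset (H := moralGraph G (ascendantsWithSelf G (B ∪ D ∪ E)))
    (D := D) (E := E)).trans
    (boundary_moralGraph_subset (G := G) (W := ascendantsWithSelf G (B ∪ D ∪ E)) (B := B) (E := E))
  refine ⟨⟨⟨hdisj, (dSeparates_iff_of_subset hG hsub).2 hsep⟩, fun M' hM' h => hmin M' hM'
    ((dSeparates_iff_of_subset hG (hM'.1.trans hsub)).1 h)⟩, fun M' hM' => ?_⟩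
  have h := (dSeparates_iff hG).1 hM'.2
  -- An arbitrary d-separator `M'` need not lie in the ancestral set of `B ∪ D ∪ E`, so its
  -- separation is read in a larger moral graph.
  have hle : moralGraph G (ascendantsWithSelf G (B ∪ D ∪ E)) ≤
      moralGraph G (ascendantsWithSelf G (B ∪ D ∪ (M' ∪ E))) :=
    moralGraph_mono G (ascendantsWithSelf_mono G
      (Set.union_subset_union_right _ Set.subset_union_right))
  refine (dSeparates_iff hG).2 (Separates.anti (moralGraph_mono G ?_) subset_rfl
    (separates_frontier_of_separates hle (hM'.1.mono_right Set.subset_union_left) h))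
  refine ascendantsWithSelf_subset ?_
  have h1 := subset_ascendantsWithSelf G (B ∪ D ∪ (M' ∪ E))
  rintro x ((hx | hx) | hx)
  · exact h1 (.inl (.inr hx))
  · exact ascendantsWithSelf_mono G (Set.union_subset_union_right _ Set.subset_union_right)
      (hsub hx)
  · exact h1 (.inr hx)

theorem IsMinimalSeparator.subset_ascendants {G : Digraph V} (hG : IsAcyclic G) {B D E M : Set V}
    (hM : IsMinimalSeparator (DSeparates G) B D E M) :
    M ⊆ ascendantsWithSelf G (B ∪ D ∪ E) := by
  by_contra hsub
  refine hM.2 (M ∩ ascendantsWithSelf G (B ∪ D ∪ E)) ⟨Set.inter_subset_left, fun h => hsub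
    fun x hx => (h hx).2⟩ ?_
  exact (dSeparates_iff_of_subset hG Set.inter_subset_right).2
    (separates_inter_ascendants hG hM.1.2)

theorem IsDirectionalMarkovBlanket.eq_moral_frontier {G : Digraph V} (hG : IsAcyclic G)
    {B D E M : Set V} {H : SimpleGraph V}
    (hH : H = moralGraph G (ascendantsWithSelf G (B ∪ D ∪ E)))
    (hM : IsDirectionalMarkovBlanket (DSeparates G) B D E M) :
    M = frontier H (boundary H B E) D E := by
  have hF := isDirectionalMarkovBlanket_moral_frontier hG hM.1.1 hH
  have hMW := hM.1.subset_ascendants hG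
  have hFW := hF.1.subset_ascendants hG
  have hFM := (dSeparates_iff hG).1 (hM.2 _ hF.1.1)
  have hFsep := (dSeparates_iff_of_subset hG hFW).1 hF.1.1.2
  subst hH
  refine eq_frontier_of_minimal hM.1.1.1 ((dSeparates_iff_of_subset hG hMW).1 hM.1.1.2)
    (fun M' hM' h => hM.1.2 M' hM' ((dSeparates_iff_of_subset hG (hM'.1.trans hMW)).2 h)) ?_
  -- The separation `hFM` lives in an ancestral set that may lack ascendants of `B`; paths from `D`
  -- can be restricted to it because the frontier separates them from `B`.
  refine separates_iff.2 fun m hm hr => separates_iff.1 hFM m hm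
    (hr.restrict hG ?_ (fun x hx => .inl (.inl hx)) (fun x hx => .inr hx) hFsep.symm)
  have h1 := subset_ascendantsWithSelf G
    (D ∪ M ∪ (frontier (moralGraph G (ascendantsWithSelf G (B ∪ D ∪ E)))
      (boundary (moralGraph G (ascendantsWithSelf G (B ∪ D ∪ E))) B E) D E ∪ E))
  rintro x ((hx | hx) | hx)
  · exact .inl hx
  · exact .inr (h1 (.inl (.inl hx)))
  · exact .inr (h1 (.inr (.inr hx)))

end DirectionalBlankets

/-! ### Markov blankets in sets -/

section BlanketsInSets

variable {V : Type u} [Fintype V] [DecidableEq V]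

theorem isMarkovBlanketIn_boundary (G : SimpleGraph V) (B E : Set V) :
    IsMarkovBlanketIn (IndepUndirected G) Set.univ B E (boundary G B E) :=
  ⟨fun _ hw => ⟨trivial, hw.1⟩, fun _ hM =>
    indepUndirected_iff.trans (separates_boundary_iff (Set.subset_univ _) hM)⟩

theorem isMarkovBlanketIn_frontier (G : SimpleGraph V) {N D E : Set V} (hND : Disjoint N D)
    (hNE : Disjoint N E) :
    IsMarkovBlanketIn (IndepUndirected G) N D E (frontier G N D E) :=
  ⟨fun _ hn => ⟨hn.1, fun h => hND.ne_of_mem hn.1 h rfl⟩, fun _ hM =>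
    indepUndirected_iff.trans (separates_frontier_iff hND hNE hM)⟩

/-- The three sets to be separated always generate the same ancestral set, so one moral graph serves
for all `M`. -/
theorem isMarkovBlanketIn_moral_boundary {G : Digraph V} (hG : IsAcyclic G) (B D E : Set V) :
    IsMarkovBlanketIn (IndepDirected G) (ascendantsWithSelf G (B ∪ D ∪ E)) B E
      (boundary (moralGraph G (ascendantsWithSelf G (B ∪ D ∪ E))) B E) := by
  refine ⟨fun w hw => ⟨boundary_moralGraph_subset hw, hw.1⟩, fun M hM => ?_⟩
  rw [indepDirected_iff hG, dSeparates_iff hG,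
    ← separates_boundary_iff boundary_moralGraph_subset hM]
  suffices ascendantsWithSelf G
      (B ∪ ascendantsWithSelf G (B ∪ D ∪ E) \ (B ∪ M) ∪ (M ∪ E)) =
      ascendantsWithSelf G (B ∪ D ∪ E) by rw [this]
  have hsub := subset_ascendantsWithSelf G (B ∪ D ∪ E)
  refine Set.Subset.antisymm (ascendantsWithSelf_subset ?_) fun x hx =>
    subset_ascendantsWithSelf G _ ?_
  · rintro x ((hx | hx) | hx | hx)
    · exact hsub (.inl (.inl hx))
    · exact hx.1
    · exact (hM hx).1
    · exact hsub (.inr hx)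
  · by_cases hxB : x ∈ B
    · exact .inl (.inl hxB)
    by_cases hxM : x ∈ M
    · exact .inr (.inl hxM)
    · exact .inl (.inr ⟨hx, fun h => h.elim hxB hxM⟩)

theorem isMarkovBlanketIn_moral_frontier {G : Digraph V} (hG : IsAcyclic G) {N D E : Set V}
    (hND : Disjoint N D) (hNE : Disjoint N E) :
    IsMarkovBlanketIn (IndepDirected G) N D E
      (frontier (moralGraph G (ascendantsWithSelf G (D ∪ N ∪ E))) N D E) := by
  refine ⟨fun n hn => ⟨hn.1, fun h => hND.ne_of_mem hn.1 h rfl⟩, fun M hM => ?_⟩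
  rw [indepDirected_iff hG, dSeparates_iff hG, ← separates_frontier_iff hND hNE hM]
  suffices D ∪ N \ (D ∪ M) ∪ (M ∪ E) = D ∪ N ∪ E by rw [this]
  ext x
  have := @hM x
  simp only [Set.mem_union, Set.mem_sdiff] at this ⊢
  tauto

end BlanketsInSets

end GraphicalModel

open GraphicalModel in
theorem mainTheorem3 {V : Type*} [Fintype V] [DecidableEq V] (B D E : Set V) :
    (∀ G : SimpleGraph V,
      (∃ S, IsSeparator (Separates G) B D E S) →
        (∃! M, IsDirectionalMarkovBlanket (Separates G) B D E M) ∧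
        ∃ N M, IsMarkovBlanketIn (IndepUndirected G) Set.univ B E N ∧
          IsMarkovBlanketIn (IndepUndirected G) N D E M ∧
          IsDirectionalMarkovBlanket (Separates G) B D E M) ∧
    (∀ G : Digraph V, IsAcyclic G →
      (∃ S, IsSeparator (DSeparates G) B D E S) →
        (∃! M, IsDirectionalMarkovBlanket (DSeparates G) B D E M) ∧
        ∃ N M, IsMarkovBlanketIn (IndepDirected G) (ascendantsWithSelf G (B ∪ D ∪ E)) B E N ∧
          IsMarkovBlanketIn (IndepDirected G) N D E M ∧
          IsDirectionalMarkovBlanket (DSeparates G) B D E M) := by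
  constructor
  · rintro G ⟨S, hS⟩
    have hM := isDirectionalMarkovBlanket_frontier hS
    refine ⟨⟨_, hM, fun M' hM' => eq_frontier_of_minimal hM'.1.1.1 hM'.1.1.2 hM'.1.2
      (hM'.2 _ hM.1.1)⟩, _, _, isMarkovBlanketIn_boundary G B E,
      isMarkovBlanketIn_frontier G (disjoint_boundary_of_separates hS.1 hS.2)
        (disjoint_boundary G B E), hM⟩
  · rintro G hG ⟨S, hS⟩
    have hM := isDirectionalMarkovBlanket_moral_frontier hG hS rfl
    have hdisj := hS.1.mono_left
      (Set.inter_subset_left (t := ascendantsWithSelf G (B ∪ D ∪ E)))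
    have hsep := separates_inter_ascendants hG hS.2
    refine ⟨⟨_, hM, fun M' hM' => hM'.eq_moral_frontier hG rfl⟩, _, _,
      isMarkovBlanketIn_moral_boundary hG B D E, isMarkovBlanketIn_moral_frontier hG
        (disjoint_boundary_of_separates hdisj hsep) (disjoint_boundary _ B E), ?_⟩
    -- The blanket of `D` in `N` is computed in the moral graph for `D ∪ N ∪ E`, the directional one
    -- in that for `B ∪ D ∪ E`; their frontiers agree because `N ∪ E` separates `D` from `B`.
    rw [frontier_moralGraph_eq hG boundary_moralGraph_subset
      (separates_boundary (inter_subset_of_separates hdisj hsep))]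
    exact hM
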